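/- **Theorem (a normal limit theorem).** Let $\mathbb T=\mathbb N=\{0,1,2,\dots\}$ or $\mathbb T=[0,\infty)$; limits $t\to\infty$ are taken along $t\in\mathbb T$. Let $X$ be a nonnegative random variable, not almost surely $0$, with $E[X^p]<\infty$ for all $p\ge 0$. For a nonnegative random variable $Y$ and $s\ge 0$ with $0<E[Y^s]<\infty$, let $Y_{(s)}$ denote a random variable with the size biased law $P(Y_{(s)}\in dx)=\frac{x^s}{E[Y^s]}P(Y\in dx)$ (with $0^0=1$). Let $(\rho_t)_{t\in\mathbb T}$ be positive numbers and put $X_t:=X_{(t)}/\rho_t$. Let $X_\infty$ be a nonnegative random variable, not almost surely $0$. 1) The following assertions are equivalent: (i) $X_t\to X_\infty$ in distribution and $\lim_{t\to\infty}E[X_t^{\lambda_0}]=E[X_\infty^{\lambda_0}]<\infty$ for some $\lambda_0\in\mathbb T\setminus\{0\}$; (ii) $X_t\to X_\infty$ in distribution and $\limsup_{t\to\infty}\rho_{t+s}/\rho_t<\infty$ for some $s\in\mathbb T\setminus\{0\}$; (iii) $E[X_\infty^\lambda]<\infty$ and $E[X_t^\lambda]\to E[X_\infty^\lambda]$ for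 all $\lambda\in[0,\infty)$. 2) If these hold, then $$\rho_t\sim\frac{1}{E[X_\infty]}\,\frac{E[X^{t+1}]}{E[X^t]}\qquad (t\to\infty),$$ and there is $c\ge 0$ such that $\lim_{t\to\infty}\rho_{t+s}/\rho_t=e^{cs}$ for every $s\in\mathbb T$. 3) Under the same assumption, with this $c$, put $a=\log E[X_\infty]$ and let $N$ be normal with mean $a-\frac c2$ and variance $c$ ($N=a$ if $c=0$). Then: (i) if $\mathbb T=\mathbb N$, then $E[X_\infty^\lambda]=E[e^{\lambda N}]=e^{(a-\frac c2)\lambda+\frac c2\lambda^2}$ for all $\lambda\in\mathbb N$; if moreover $c>0$, the law of $X_\infty$ is not determined by its integer moments, i.e. some other law on $[0,\infty)$ has the same moments of all orders in $\mathbb N$; (ii) if $\mathbb T=[0,\infty)$, then $X_\infty>0$ almost surely, $\log X_\infty$ has the law of $N$, and $E[X_\infty^\lambda]=E[e^{\lambda N}]=e^{(a-\frac c2)\lambda+\frac c2\lambda^2}$ for all $\lambda\in[0,\infty)$; (iii) $(X_\infty)_{(s)}$ has the same law as $e^{cs}X_\infty$ for every $s\in\mathbb T$. -/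

import Mathlib

open MeasureTheory ProbabilityTheory Filter Topology Asymptotics
open scoped ENNReal NNReal BoundedContinuousFunction

namespace SizeBias

/-- The size biased law of order `t` of a law `μ` on the nonnegative half-line:
`x ^ t / E[X ^ t] · P(X ∈ dx)`, with the convention `0 ^ 0 = 1`. -/
noncomputable def sizeBiased (μ : Measure ℝ) (t : ℝ) : Measure ℝ :=
  μ.withDensity fun x => ENNReal.ofReal (x ^ t / ∫ y, y ^ t ∂μ)

/-- The law of `X_t = X_(t) / ρ_t`, where `X` has law `μ`. -/
noncomputable def scaledLaw (μ : Measure ℝ) (ρ : ℝ → ℝ) (t : ℝ) : Measure ℝ :=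
  (sizeBiased μ t).map fun x => x / ρ t

/-- The filter `t → ∞` with `t` restricted to the time set `T`. -/
def infty (T : Set ℝ) : Filter ℝ := atTop ⊓ 𝓟 T

/-- Convergence in distribution along a filter: `E[f(X_i)] → E[f(X_∞)]` for every bounded
continuous real function `f`. -/
def ConvergesInLaw {ι : Type*} (l : Filter ι) (μs : ι → Measure ℝ) (ν : Measure ℝ) : Prop :=
  ∀ f : ℝ →ᵇ ℝ, Tendsto (fun i => ∫ x, f x ∂(μs i)) l (𝓝 (∫ x, f x ∂ν))

/-- On probability measures this is convergence in the topology of weak convergence. -/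
theorem convergesInLaw_iff {ι : Type*} (l : Filter ι) (μs : ι → ProbabilityMeasure ℝ)
    (ν : ProbabilityMeasure ℝ) :
    ConvergesInLaw l (fun i => (μs i : Measure ℝ)) (ν : Measure ℝ) ↔ Tendsto μs l (𝓝 ν) :=
  ProbabilityMeasure.tendsto_iff_forall_integral_tendsto.symm

/-- The `p`-th moment of `ν` is finite, and the `p`-th moments of `μs i` converge to it. -/
def MomentConverges {ι : Type*} (l : Filter ι) (μs : ι → Measure ℝ) (ν : Measure ℝ)
    (p : ℝ) : Prop :=
  Integrable (fun x : ℝ => x ^ p) ν ∧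
    Tendsto (fun i => ∫ x, x ^ p ∂(μs i)) l (𝓝 (∫ x, x ^ p ∂ν))

/-- Convergence in distribution together with convergence of one positive moment. -/
def ConvLawAndMoment (T : Set ℝ) (μ : Measure ℝ) (ρ : ℝ → ℝ) (ν : Measure ℝ) : Prop :=
  ConvergesInLaw (infty T) (scaledLaw μ ρ) ν ∧
    ∃ p ∈ T \ {0}, MomentConverges (infty T) (scaledLaw μ ρ) ν p

/-- Convergence in distribution together with `limsup ρ_{t+s} / ρ_t < ∞` for some `s`; the
upper limit is taken in `[0, ∞]`. -/
def ConvLawAndRatio (T : Set ℝ) (μ : Measure ℝ) (ρ : ℝ → ℝ) (ν : Measure ℝ) : Prop :=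
  ConvergesInLaw (infty T) (scaledLaw μ ρ) ν ∧
    ∃ s ∈ T \ {0}, limsup (fun t => ENNReal.ofReal (ρ (t + s) / ρ t)) (infty T) < ∞

/-- Convergence of all moments of nonnegative real order to finite limits. -/
def ConvAllMoments (T : Set ℝ) (μ : Measure ℝ) (ρ : ℝ → ℝ) (ν : Measure ℝ) : Prop :=
  ∀ p : ℝ, 0 ≤ p → MomentConverges (infty T) (scaledLaw μ ρ) ν p

/-- The law `ν` on the half-line is not determined by its integer moments. -/
def MomentIndeterminate (ν : Measure ℝ) : Prop :=
  ∃ ν' : Measure ℝ, IsProbabilityMeasure ν' ∧ (∀ᵐ x ∂ν', 0 ≤ x) ∧ ν' ≠ ν ∧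
    ∀ n : ℕ, Integrable (fun x : ℝ => x ^ n) ν' ∧ ∫ x, x ^ n ∂ν' = ∫ x, x ^ n ∂ν

end SizeBias

/-! Size biasing composes: biasing `X_t` by `s` gives `r X_{t+s}` with `r = ρ (t + s) / ρ t`. In
moments, `E[X_t^(s+p)] = E[X_t^s] r^p E[X_{t+s}^p]` (`integral_mul_rpow_scaledLaw`,
`moment_add_scaledLaw`).

Equivalences. If `E[X_t^s]` converges, the biased laws, i.e. those of `r X_{t+s}`, keep their mass
from escaping; since `X_{t+s}` has a nonnull limit, `r` stays bounded. Conversely, bounded `r` makes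
the biased laws tight, which bounds `E[X_t^s]`; iterating the moment identity bounds the orders `n
s`, and uniform integrability gives convergence of every moment. Convergence of all real moments
gives back convergence in law by tightness and uniqueness: real moments, unlike integer ones,
determine a law on the half-line, because the Mellin transform is analytic (`FiniteMomentLaw.ext`).

Limit. Letting `t → ∞`, the moments `m` of `X_∞` satisfy `m (s + p) = m s * exp (c s p) * m p`.
Hence `log m` is a quadratic plus an additive function. Induction settles the integers; on `[0, ∞)`
the local bound on `m` excludes a nonzero additive remainder, and uniqueness then identifies the
lognormal law. Over `ℕ`, a sine perturbation of the Gaussian gives a second law with the same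
integer moments. -/

namespace SizeBias

/-! ### Weak convergence: Fatou and uniform integrability. -/

section WeakConvergence

variable {ι : Type*} {l : Filter ι} {μs : ι → Measure ℝ} {ν : Measure ℝ}

theorem ConvergesInLaw.tendsto_integral (h : ConvergesInLaw l μs ν) {f : ℝ → ℝ}
    (hf : Continuous f) {C : ℝ} (hC : ∀ x, |f x| ≤ C) :
    Tendsto (fun i => ∫ x, f x ∂(μs i)) l (𝓝 (∫ x, f x ∂ν)) :=
  h (BoundedContinuousFunction.ofNormedAddCommGroup f hf C hC)

theorem integrable_of_continuous_of_bounded [IsFiniteMeasure ν] {f : ℝ → ℝ}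
    (hf : Continuous f) {C : ℝ} (hC : ∀ x, |f x| ≤ C) : Integrable f ν :=
  Integrable.of_bound hf.aestronglyMeasurable C (ae_of_all _ hC)

/-- Fatou's lemma for convergence in distribution. -/
theorem ConvergesInLaw.integral_le [l.NeBot] [IsProbabilityMeasure ν]
    (h : ConvergesInLaw l μs ν) (hprob : ∀ᶠ i in l, IsProbabilityMeasure (μs i))
    {u : ℝ → ℝ} (hu : Continuous u) (hu0 : ∀ x, 0 ≤ u x) {C : ℝ}
    (hC : ∀ᶠ i in l, Integrable u (μs i) ∧ ∫ x, u x ∂(μs i) ≤ C) :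
    Integrable u ν ∧ ∫ x, u x ∂ν ≤ C := by
  have hcont (n : ℕ) : Continuous fun x => min (u x) n := hu.min continuous_const
  have hbd (n : ℕ) (x : ℝ) : |min (u x) (n : ℝ)| ≤ n := by
    rw [abs_of_nonneg (le_min (hu0 x) n.cast_nonneg)]
    exact min_le_right _ _
  have hC0 : 0 ≤ C := by
    obtain ⟨i, hi⟩ := hC.exists
    exact (integral_nonneg hu0).trans hi.2
  have hmin (n : ℕ) : ∫ x, min (u x) n ∂ν ≤ C := by
    refine le_of_tendsto (h.tendsto_integral (hcont n) (hbd n)) ?_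
    filter_upwards [hC, hprob] with i hi hp
    exact (integral_mono (integrable_of_continuous_of_bounded (hcont n) (hbd n)) hi.1
      fun x => min_le_left _ _).trans hi.2
  have hlim : Tendsto (fun n : ℕ => ∫⁻ x, ENNReal.ofReal (min (u x) n) ∂ν) atTop
      (𝓝 (∫⁻ x, ENNReal.ofReal (u x) ∂ν)) := by
    refine lintegral_tendsto_of_tendsto_of_monotone
      (fun n => (hcont n).measurable.ennreal_ofReal.aemeasurable) (ae_of_all _ fun x => ?_)
      (ae_of_all _ fun x => ?_)
    · intro m n hmn
      exact ENNReal.ofReal_le_ofReal (min_le_min_left _ (by exact_mod_cast hmn))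
    · refine tendsto_const_nhds.congr' ?_
      obtain ⟨N, hN⟩ := exists_nat_ge (u x)
      filter_upwards [eventually_ge_atTop N] with n hn
      rw [min_eq_left (hN.trans (by exact_mod_cast hn))]
  have hle : ∫⁻ x, ENNReal.ofReal (u x) ∂ν ≤ ENNReal.ofReal C := by
    refine le_of_tendsto' hlim fun n => ?_
    rw [← ofReal_integral_eq_lintegral_ofReal
      (integrable_of_continuous_of_bounded (hcont n) (hbd n))
      (ae_of_all _ fun x => le_min (hu0 x) n.cast_nonneg)]
    exact ENNReal.ofReal_le_ofReal (hmin n)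
  have hint : Integrable u ν := by
    refine ⟨hu.aestronglyMeasurable, ?_⟩
    rw [hasFiniteIntegral_iff_ofReal (ae_of_all _ hu0)]
    exact hle.trans_lt ENNReal.ofReal_lt_top
  refine ⟨hint, ?_⟩
  rw [← ofReal_integral_eq_lintegral_ofReal hint (ae_of_all _ hu0)] at hle
  exact (ENNReal.ofReal_le_ofReal_iff hC0).1 hle

theorem integrable_of_integrable_sq [IsProbabilityMeasure ν] {u : ℝ → ℝ}
    (hu : Continuous u) (h : Integrable (fun x => u x ^ 2) ν) : Integrable u ν := by
  refine ((integrable_const (1 : ℝ)).add h).mono' hu.aestronglyMeasurable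
    (ae_of_all _ fun x => ?_)
  simp only [Pi.add_apply, Real.norm_eq_abs]
  nlinarith [sq_abs (u x), sq_nonneg (|u x| - 1), abs_nonneg (u x)]

/-- Since `u - min u K ≤ u ^ 2 / K`, the truncation error is controlled by the second moment alone,
hence uniformly over laws. -/
theorem abs_integral_sub_integral_min_le [IsProbabilityMeasure ν] {u : ℝ → ℝ}
    (hu : Continuous u) (hu0 : ∀ x, 0 ≤ u x) (h : Integrable (fun x => u x ^ 2) ν)
    {K C : ℝ} (hK : 0 < K) (hC : ∫ x, u x ^ 2 ∂ν ≤ C) :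
    |∫ x, u x ∂ν - ∫ x, min (u x) K ∂ν| ≤ C / K := by
  have hbd (x : ℝ) : |min (u x) K| ≤ K := by
    rw [abs_of_nonneg (le_min (hu0 x) hK.le)]
    exact min_le_right _ _
  have hint := integrable_of_continuous_of_bounded (ν := ν) (hu.min continuous_const) hbd
  rw [← integral_sub (integrable_of_integrable_sq hu h) hint, abs_of_nonneg
    (integral_nonneg fun x => sub_nonneg.2 (min_le_left _ _))]
  calc ∫ x, u x - min (u x) K ∂ν ≤ ∫ x, u x ^ 2 / K ∂ν := by
        refine integral_mono ((integrable_of_integrable_sq hu h).sub hint) (h.div_const K) ?_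
        intro x
        rw [le_div_iff₀ hK]
        rcases le_total (u x) K with hx | hx
        · simp only [min_eq_left hx]
          nlinarith [sq_nonneg (u x)]
        · simp only [min_eq_right hx]
          nlinarith [hu0 x]
    _ ≤ C / K := by
        rw [integral_div]
        gcongr

/-- Bounded second moments of a nonnegative observable make its expectations converge. -/
theorem ConvergesInLaw.tendsto_integral_of_sq_le [l.NeBot] [IsProbabilityMeasure ν]
    (h : ConvergesInLaw l μs ν) (hprob : ∀ᶠ i in l, IsProbabilityMeasure (μs i))
    {u : ℝ → ℝ} (hu : Continuous u) (hu0 : ∀ x, 0 ≤ u x) {C : ℝ}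
    (hC : ∀ᶠ i in l, Integrable (fun x => u x ^ 2) (μs i) ∧ ∫ x, u x ^ 2 ∂(μs i) ≤ C) :
    Integrable u ν ∧ Tendsto (fun i => ∫ x, u x ∂(μs i)) l (𝓝 (∫ x, u x ∂ν)) := by
  obtain ⟨hint, hle⟩ := h.integral_le hprob (hu.pow 2) (fun x => sq_nonneg _) hC
  refine ⟨integrable_of_integrable_sq hu hint, ?_⟩
  rw [Metric.tendsto_nhds]
  intro ε hε
  have hC0 : 0 ≤ C := (integral_nonneg fun x => sq_nonneg _).trans hle
  -- Three-epsilon argument: two truncation errors, each at most `C / K`, and weak convergence of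
  -- the truncated observable.
  obtain ⟨K, hK, hKε⟩ : ∃ K : ℝ, 0 < K ∧ C / K < ε / 3 := by
    refine ⟨3 * (C + 1) / ε, by positivity, ?_⟩
    rw [div_lt_iff₀ (by positivity)]
    field_simp
    linarith
  have hbd (x : ℝ) : |min (u x) K| ≤ K := by
    rw [abs_of_nonneg (le_min (hu0 x) hK.le)]
    exact min_le_right _ _
  have hlim := h.tendsto_integral (hu.min continuous_const) hbd
  filter_upwards [hprob, hC, Metric.tendsto_nhds.1 hlim (ε / 3) (by positivity)] with i hp hi hd
  have h1 := abs_integral_sub_integral_min_le hu hu0 hi.1 hK hi.2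
  have h2 := abs_integral_sub_integral_min_le hu hu0 hint hK hle
  rw [Real.dist_eq] at hd ⊢
  rw [abs_le] at h1 h2
  rw [abs_lt] at hd ⊢
  constructor <;> linarith [h1.1, h1.2, h2.1, h2.2, hd.1, hd.2]

end WeakConvergence

/-- A law on the half-line all of whose moments of nonnegative order are finite. -/
structure FiniteMomentLaw (μ : Measure ℝ) : Prop where
  prob : IsProbabilityMeasure μ
  nonneg : ∀ᵐ x ∂μ, 0 ≤ x
  integrable : ∀ p : ℝ, 0 ≤ p → Integrable (fun x : ℝ => x ^ p) μ

/-! ### Convergence of moments under weak convergence. -/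

section Moments

variable {ι : Type*} {l : Filter ι} {μs : ι → Measure ℝ} {ν : Measure ℝ}

/-- At negative `x` the value `x ^ p` may be negative; the positive part supplies a continuous
nonnegative observable that agrees with `x ^ p` on the half-line. -/
theorem continuous_posPart_rpow {p : ℝ} (hp : 0 ≤ p) : Continuous fun x : ℝ => (max x 0) ^ p :=
  (continuous_id.max continuous_const).rpow_const fun _ => Or.inr hp

theorem rpow_ae_eq_posPart_rpow (hν : ∀ᵐ x ∂ν, 0 ≤ x) (p : ℝ) :
    (fun x : ℝ => (max x 0) ^ p) =ᵐ[ν] fun x => x ^ p := by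
  filter_upwards [hν] with x hx
  rw [max_eq_left hx]

theorem ConvergesInLaw.momentConverges [l.NeBot] [IsProbabilityMeasure ν]
    (hν : ∀ᵐ x ∂ν, 0 ≤ x) (h : ConvergesInLaw l μs ν)
    (hμs : ∀ᶠ i in l, FiniteMomentLaw (μs i)) {p : ℝ} (hp : 0 ≤ p) {C : ℝ}
    (hC : ∀ᶠ i in l, ∫ x, x ^ (p + p) ∂(μs i) ≤ C) : MomentConverges l μs ν p := by
  have hsq (x : ℝ) : ((max x 0) ^ p) ^ 2 = (max x 0) ^ (p + p) := by
    rw [sq, Real.rpow_add_of_nonneg (le_max_right _ _) hp hp]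
  obtain ⟨h1, h2⟩ := h.tendsto_integral_of_sq_le (hμs.mono fun i hi => hi.prob)
    (continuous_posPart_rpow hp) (fun x => by positivity) (C := C) (by
      filter_upwards [hμs, hC] with i hi hCi
      simp only [hsq]
      have := rpow_ae_eq_posPart_rpow hi.nonneg (p + p)
      rw [integral_congr_ae this]
      exact ⟨(hi.integrable _ (by positivity)).congr this.symm, hCi⟩)
  refine ⟨h1.congr (rpow_ae_eq_posPart_rpow hν p), ?_⟩
  rw [integral_congr_ae (rpow_ae_eq_posPart_rpow hν p)] at h2
  refine h2.congr' ?_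
  filter_upwards [hμs] with i hi
  exact integral_congr_ae (rpow_ae_eq_posPart_rpow hi.nonneg p)

/-- The half-line is closed under convergence in distribution. -/
theorem ConvergesInLaw.ae_nonneg [l.NeBot] [IsProbabilityMeasure ν]
    (h : ConvergesInLaw l μs ν) (hprob : ∀ᶠ i in l, IsProbabilityMeasure (μs i))
    (hμs : ∀ᶠ i in l, ∀ᵐ x ∂(μs i), 0 ≤ x) : ∀ᵐ x ∂ν, 0 ≤ x := by
  -- Fatou for the negative part, whose expectations are eventually zero.
  obtain ⟨h1, h2⟩ := h.integral_le hprob (u := fun x => max (-x) 0) (C := 0) (by fun_prop)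
    (fun x => le_max_right _ _) (by
      filter_upwards [hμs] with i hi
      have : (fun x : ℝ => max (-x) 0) =ᵐ[μs i] 0 := by
        filter_upwards [hi] with x hx
        simp [hx]
      rw [integral_congr_ae this]
      exact ⟨(integrable_zero ℝ ℝ _).congr this.symm, by simp⟩)
  have h3 := (integral_eq_zero_iff_of_nonneg (fun x => le_max_right _ _) h1).1
    (le_antisymm h2 (integral_nonneg fun x => le_max_right _ _))
  filter_upwards [h3] with x hx
  simpa using hx

end Moments

/-! ### Real-order moments determine a law on the half-line. -/

section Uniqueness

/-- The weight `x` removes a possible atom at `0`, so that `Real.log` loses nothing, and shifts the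
domain of the moments to `p > -1`, which has `0` in its interior. -/
theorem integral_withDensity_id {E : Type*} [NormedAddCommGroup E] [NormedSpace ℝ E]
    {ν : Measure ℝ} (hν : ∀ᵐ x ∂ν, 0 ≤ x) (g : ℝ → E) :
    ∫ x, g x ∂(ν.withDensity fun x => ENNReal.ofReal x) = ∫ x, x • g x ∂ν := by
  rw [integral_withDensity_eq_integral_toReal_smul ENNReal.measurable_ofReal (by simp)]
  refine integral_congr_ae ?_
  filter_upwards [hν] with x hx
  rw [ENNReal.toReal_ofReal hx]

theorem integrable_withDensity_id {ν : Measure ℝ} (hν : ∀ᵐ x ∂ν, 0 ≤ x) {g : ℝ → ℝ} :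
    Integrable g (ν.withDensity fun x => ENNReal.ofReal x) ↔ Integrable (fun x => x * g x) ν := by
  rw [integrable_withDensity_iff_integrable_smul' ENNReal.measurable_ofReal (by simp)]
  refine integrable_congr ?_
  filter_upwards [hν] with x hx
  rw [ENNReal.toReal_ofReal hx, smul_eq_mul]

/-- At `x = 0`, where `Real.log 0 = 0`, the factor `x` kills the left side, and `p + 1 > 0` the
right. -/
theorem mul_exp_mul_log_eq_rpow {x p : ℝ} (hx : 0 ≤ x) (hp : -1 < p) :
    x * Real.exp (p * Real.log x) = x ^ (p + 1) := by
  rcases hx.eq_or_lt with rfl | hx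
  · rw [zero_mul, Real.zero_rpow (by linarith)]
  · rw [Real.rpow_add_one hx.ne', Real.rpow_def_of_pos hx, mul_comm, mul_comm p]

theorem map_exp_map_log_withDensity_id (ν : Measure ℝ) :
    ((ν.withDensity fun x => ENNReal.ofReal x).map Real.log).map Real.exp =
      ν.withDensity fun x => ENNReal.ofReal x := by
  rw [Measure.map_map Real.measurable_exp Real.measurable_log]
  conv_rhs => rw [← Measure.map_id (μ := ν.withDensity fun x => ENNReal.ofReal x)]
  refine Measure.map_congr ?_
  refine (ae_withDensity_iff ENNReal.measurable_ofReal).2 (ae_of_all _ fun x hx => ?_)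
  have : 0 < x := by simpa using hx
  simp [Real.exp_log this]

namespace FiniteMomentLaw

variable {ν : Measure ℝ}

theorem isFiniteMeasure_withDensity_id (h : FiniteMomentLaw ν) :
    IsFiniteMeasure (ν.withDensity fun x => ENNReal.ofReal x) := by
  refine isFiniteMeasure_withDensity_ofReal ?_
  simpa using (h.integrable 1 zero_le_one).2

theorem mem_integrableExpSet_log (h : FiniteMomentLaw ν) {p : ℝ} (hp : -1 < p) :
    p ∈ integrableExpSet Real.log (ν.withDensity fun x => ENNReal.ofReal x) := by
  change Integrable _ _
  rw [integrable_withDensity_id h.nonneg]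
  refine (h.integrable (p + 1) (by linarith)).congr ?_
  filter_upwards [h.nonneg] with x hx
  rw [mul_exp_mul_log_eq_rpow hx hp]

theorem mgf_log_withDensity_id (h : FiniteMomentLaw ν) {p : ℝ} (hp : -1 < p) :
    mgf Real.log (ν.withDensity fun x => ENNReal.ofReal x) p = ∫ x, x ^ (p + 1) ∂ν := by
  rw [mgf, integral_withDensity_id h.nonneg]
  refine integral_congr_ae ?_
  filter_upwards [h.nonneg] with x hx
  rw [smul_eq_mul, mul_exp_mul_log_eq_rpow hx hp]

/-- The weighted measure does not see an atom at `0`, but `exp (iξx) - 1` vanishes there, so it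
recovers `ν` once the total mass is known to be `1`. -/
theorem charFun_eq (h : FiniteMomentLaw ν) (ξ : ℝ) :
    charFun ν ξ = 1 + ∫ x : ℝ, ((Complex.exp (ξ * x * Complex.I) - 1) / (x : ℂ))
      ∂(ν.withDensity fun x => ENNReal.ofReal x) := by
  have := h.prob
  rw [integral_withDensity_id h.nonneg, charFun_apply_real]
  have hint : Integrable (fun x : ℝ => Complex.exp (ξ * x * Complex.I)) ν := by
    refine Integrable.of_bound (by fun_prop) 1 (ae_of_all _ fun x => ?_)
    rw [← Complex.ofReal_mul, Complex.norm_exp_ofReal_mul_I]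
  have heq : ∫ x : ℝ, x • ((Complex.exp (ξ * x * Complex.I) - 1) / (x : ℂ)) ∂ν =
      ∫ x : ℝ, (Complex.exp (ξ * x * Complex.I) - 1) ∂ν := by
    congr 1 with x
    rw [Complex.real_smul]
    rcases eq_or_ne x 0 with rfl | hx
    · simp
    · have : (x : ℂ) ≠ 0 := by exact_mod_cast hx
      field_simp
  rw [heq, integral_sub hint (integrable_const _)]
  simp

end FiniteMomentLaw

/-- A law on the half-line with finite moments of all nonnegative real orders is determined by
them. -/
theorem FiniteMomentLaw.ext {ν₁ ν₂ : Measure ℝ} (h₁ : FiniteMomentLaw ν₁)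
    (h₂ : FiniteMomentLaw ν₂) (h : ∀ p : ℝ, 0 ≤ p → ∫ x, x ^ p ∂ν₁ = ∫ x, x ^ p ∂ν₂) :
    ν₁ = ν₂ := by
  have := h₁.prob
  have := h₂.prob
  have := h₁.isFiniteMeasure_withDensity_id
  have := h₂.isFiniteMeasure_withDensity_id
  set κ₁ := ν₁.withDensity fun x => ENNReal.ofReal x with hκ₁
  set κ₂ := ν₂.withDensity fun x => ENNReal.ofReal x with hκ₂
  have hint {ν : Measure ℝ} (hν : FiniteMomentLaw ν) : {z : ℂ | z.re ∈ Set.Ioi (-1 : ℝ)} ⊆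
      {z : ℂ | z.re ∈ interior
        (integrableExpSet Real.log (ν.withDensity fun x => ENNReal.ofReal x))} := fun z hz =>
    (interior_maximal (fun p hp => hν.mem_integrableExpSet_log hp) isOpen_Ioi) hz
  have hX : AnalyticOnNhd ℂ (complexMGF Real.log κ₁) {z | z.re ∈ Set.Ioi (-1 : ℝ)} :=
    analyticOnNhd_complexMGF.mono (hint h₁)
  have hY : AnalyticOnNhd ℂ (complexMGF Real.log κ₂) {z | z.re ∈ Set.Ioi (-1 : ℝ)} :=
    analyticOnNhd_complexMGF.mono (hint h₂)
  -- Identity theorem on `Re z > -1`: the transforms agree at real points accumulating at `0`, hence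
  -- on the imaginary axis, where they are characteristic functions of the logarithm.
  have hreal : ∀ᶠ x : ℝ in 𝓝[≠] 0, complexMGF Real.log κ₁ x = complexMGF Real.log κ₂ x := by
    filter_upwards [mem_nhdsWithin_of_mem_nhds (Ioi_mem_nhds (show (-1 : ℝ) < 0 by norm_num))]
      with x hx
    rw [complexMGF_ofReal, complexMGF_ofReal, h₁.mgf_log_withDensity_id hx,
      h₂.mgf_log_withDensity_id hx, h _ (by linarith [Set.mem_Ioi.1 hx])]
  have hmap : Tendsto (fun x : ℝ => (x : ℂ)) (𝓝[≠] 0) (𝓝[≠] 0) := by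
    refine tendsto_nhdsWithin_iff.2 ⟨?_, ?_⟩
    · exact (Complex.continuous_ofReal.tendsto' 0 0 (by simp)).mono_left nhdsWithin_le_nhds
    · filter_upwards [self_mem_nhdsWithin] with x hx
      simpa using hx
  have heq := AnalyticOnNhd.eqOn_of_preconnected_of_frequently_eq hX hY
    ((convex_Ioi (-1 : ℝ)).linear_preimage Complex.reLm).isPreconnected (z₀ := 0) (by simp)
    (hmap.frequently hreal.frequently)
  have hlog : κ₁.map Real.log = κ₂.map Real.log := by
    refine Measure.ext_of_charFun (funext fun t => ?_)
    rw [← complexMGF_mul_I Real.measurable_log.aemeasurable,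
      ← complexMGF_mul_I Real.measurable_log.aemeasurable]
    exact heq (by simp)
  have hκ : κ₁ = κ₂ := by
    rw [hκ₁, hκ₂, ← map_exp_map_log_withDensity_id ν₁, ← map_exp_map_log_withDensity_id ν₂]
    exact congrArg _ hlog
  refine Measure.ext_of_charFun (funext fun ξ => ?_)
  rw [h₁.charFun_eq, h₂.charFun_eq, ← hκ₁, ← hκ₂, hκ]

end Uniqueness

/-! ### Tightness and the method of moments. -/

section Compactness

theorem isTightMeasureSet_of_integral_le (C : ℝ) :
    IsTightMeasureSet {μ : Measure ℝ | FiniteMomentLaw μ ∧ ∫ x, x ^ (1 : ℝ) ∂μ ≤ C} := by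
  rw [isTightMeasureSet_iff_exists_isCompact_measure_compl_le]
  intro ε hε
  rcases eq_or_ne ε ∞ with rfl | hε'
  · exact ⟨∅, isCompact_empty, fun μ _ => le_top⟩
  have he : 0 < ε.toReal := ENNReal.toReal_pos hε.ne' hε'
  set R := (|C| + 1) / ε.toReal with hR
  have hR0 : 0 < R := by positivity
  refine ⟨Set.Icc 0 R, isCompact_Icc, fun μ hμ => ?_⟩
  obtain ⟨hμ, hC⟩ := hμ
  have := hμ.prob
  have h1 : μ (Set.Icc 0 R)ᶜ ≤ μ {x | R ≤ x} := by
    refine measure_mono_ae ?_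
    filter_upwards [hμ.nonneg] with x hx hx'
    exact (not_le.1 fun h => hx' ⟨hx, h⟩).le
  have h2 := mul_meas_ge_le_integral_of_nonneg (μ := μ) (f := fun x : ℝ => x ^ (1 : ℝ))
    (by filter_upwards [hμ.nonneg] with x hx using by simpa using hx)
    (hμ.integrable 1 zero_le_one) R
  simp only [Real.rpow_one] at h2 hC
  refine h1.trans ?_
  rw [← ENNReal.ofReal_toReal hε', ← ofReal_measureReal]
  refine ENNReal.ofReal_le_ofReal ?_
  have h3 : R * ε.toReal = |C| + 1 := by rw [hR]; field_simp
  have h4 : R * μ.real {x | R ≤ x} ≤ R * ε.toReal := by linarith [le_abs_self C]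
  exact le_of_mul_le_mul_left h4 hR0

variable {ι : Type*} {l : Filter ι} {μs : ι → Measure ℝ} {ν : Measure ℝ}

theorem MomentConverges.eventually_le {p : ℝ} (h : MomentConverges l μs ν p) :
    ∀ᶠ i in l, ∫ x, x ^ p ∂(μs i) ≤ ∫ x, x ^ p ∂ν + 1 :=
  h.2.eventually_le_const (by linarith)

/-- The method of moments, for all moments of nonnegative real order. -/
theorem convergesInLaw_of_momentConverges [IsProbabilityMeasure ν] (hν : ∀ᵐ x ∂ν, 0 ≤ x)
    (hμs : ∀ᶠ i in l, FiniteMomentLaw (μs i))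
    (h : ∀ p : ℝ, 0 ≤ p → MomentConverges l μs ν p) : ConvergesInLaw l μs ν := by
  intro f
  -- Along each ultrafilter the tight family has a weak limit, so it suffices to identify that
  -- limit; no subsequences are needed.
  rw [tendsto_iff_ultrafilter]
  intro g hg
  classical
  -- The default value `ν` is used only at indices outside an eventual set.
  let Q : ι → ProbabilityMeasure ℝ := fun i =>
    if hi : IsProbabilityMeasure (μs i) then ⟨μs i, hi⟩ else ⟨ν, inferInstance⟩
  have hQ : ∀ i, FiniteMomentLaw (μs i) → (Q i : Measure ℝ) = μs i := fun i hi => by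
    have := hi.prob
    simp [Q, this]
  set C := ∫ x, x ^ (1 : ℝ) ∂ν + 1
  let S : Set (ProbabilityMeasure ℝ) :=
    {P | FiniteMomentLaw (P : Measure ℝ) ∧ ∫ x, x ^ (1 : ℝ) ∂(P : Measure ℝ) ≤ C}
  have hS : IsCompact (closure S) := by
    refine isCompact_closure_of_isTightMeasureSet
      ((isTightMeasureSet_of_integral_le C).subset ?_)
    rintro _ ⟨P, hP, rfl⟩
    exact hP
  have hmem : ∀ᶠ i in (g : Filter ι), Q i ∈ closure S := by
    filter_upwards [hg hμs, hg (h 1 zero_le_one).eventually_le] with i hi hi'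
    refine subset_closure ⟨?_, ?_⟩
    · rwa [hQ i hi]
    · rwa [hQ i hi]
  obtain ⟨P, -, hP⟩ := hS.ultrafilter_le_nhds (g.map Q) (le_principal_iff.2 hmem)
  have hconv : ConvergesInLaw (g : Filter ι) μs (P : Measure ℝ) := fun f => by
    refine ((convergesInLaw_iff _ Q P).2 hP f).congr' ?_
    filter_upwards [hg hμs] with i hi
    rw [hQ i hi]
  have hPnn := hconv.ae_nonneg (hg (hμs.mono fun i hi => hi.prob))
    (hg (hμs.mono fun i hi => hi.nonneg))
  have hmom (p : ℝ) (hp : 0 ≤ p) : MomentConverges (g : Filter ι) μs (P : Measure ℝ) p :=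
    hconv.momentConverges hPnn (hg hμs) hp (hg (h (p + p) (by positivity)).eventually_le)
  have hPν : (P : Measure ℝ) = ν := by
    refine FiniteMomentLaw.ext ⟨inferInstance, hPnn, fun p hp => (hmom p hp).1⟩
      ⟨inferInstance, hν, fun p hp => (h p hp).1⟩ fun p hp => ?_
    exact tendsto_nhds_unique (hmom p hp).2 ((h p hp).2.mono_left hg)
  rw [← hPν]
  exact hconv f

end Compactness

/-! ### Size biased and rescaled laws. -/

section ScaledLaw

theorem integral_rpow_pos {ν : Measure ℝ} [IsProbabilityMeasure ν] (hν : ∀ᵐ x ∂ν, 0 ≤ x)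
    (hν0 : ¬ ∀ᵐ x ∂ν, x = 0) {p : ℝ} (hint : Integrable (fun x : ℝ => x ^ p) ν) :
    0 < ∫ x, x ^ p ∂ν := by
  have h0 : 0 ≤ᵐ[ν] fun x : ℝ => x ^ p := by
    filter_upwards [hν] with x hx using Real.rpow_nonneg hx p
  refine (integral_nonneg_of_ae h0).lt_of_ne' fun h => hν0 ?_
  filter_upwards [(integral_eq_zero_iff_of_nonneg_ae h0 hint).1 h, hν] with x hx hx0
  by_contra hne
  exact (Real.rpow_pos_of_pos (lt_of_le_of_ne hx0 (Ne.symm hne)) p).ne' hx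

variable {μ : Measure ℝ}

theorem measurable_sizeBiased_density (μ : Measure ℝ) (t : ℝ) :
    Measurable fun x : ℝ => ENNReal.ofReal (x ^ t / ∫ y, y ^ t ∂μ) := by
  fun_prop

theorem integral_rpow_nonneg (hμ : ∀ᵐ x ∂μ, 0 ≤ x) (t : ℝ) : 0 ≤ ∫ y, y ^ t ∂μ :=
  integral_nonneg_of_ae (by filter_upwards [hμ] with x hx using Real.rpow_nonneg hx t)

theorem integral_sizeBiased (hμ : ∀ᵐ x ∂μ, 0 ≤ x) (t : ℝ) (g : ℝ → ℝ) :
    ∫ x, g x ∂(sizeBiased μ t) = (∫ x, x ^ t * g x ∂μ) / ∫ x, x ^ t ∂μ := by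
  rw [sizeBiased, integral_withDensity_eq_integral_toReal_smul (measurable_sizeBiased_density μ t)
    (by simp), ← integral_div]
  refine integral_congr_ae ?_
  filter_upwards [hμ] with x hx
  rw [ENNReal.toReal_ofReal (div_nonneg (Real.rpow_nonneg hx t) (integral_rpow_nonneg hμ t)),
    smul_eq_mul]
  ring

theorem integrable_sizeBiased (hμ : ∀ᵐ x ∂μ, 0 ≤ x) {t : ℝ} {g : ℝ → ℝ}
    (hg : Integrable (fun x => x ^ t * g x) μ) : Integrable g (sizeBiased μ t) := by
  rw [sizeBiased, integrable_withDensity_iff_integrable_smul' (measurable_sizeBiased_density μ t)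
    (by simp)]
  refine (hg.div_const (∫ x, x ^ t ∂μ)).congr ?_
  filter_upwards [hμ] with x hx
  rw [ENNReal.toReal_ofReal (div_nonneg (Real.rpow_nonneg hx t) (integral_rpow_nonneg hμ t)),
    smul_eq_mul]
  ring

namespace FiniteMomentLaw

theorem sizeBiased (hμ : FiniteMomentLaw μ) (hμ0 : ¬ ∀ᵐ x ∂μ, x = 0) {t : ℝ} (ht : 0 ≤ t) :
    FiniteMomentLaw (sizeBiased μ t) := by
  have := hμ.prob
  have hpos := integral_rpow_pos hμ.nonneg hμ0 (hμ.integrable t ht)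
  refine ⟨⟨?_⟩, ?_, fun p hp => integrable_sizeBiased hμ.nonneg ?_⟩
  · rw [SizeBias.sizeBiased, withDensity_apply _ MeasurableSet.univ, Measure.restrict_univ,
      ← ofReal_integral_eq_lintegral_ofReal ((hμ.integrable t ht).div_const _), integral_div,
      div_self hpos.ne', ENNReal.ofReal_one]
    filter_upwards [hμ.nonneg] with x hx using div_nonneg (Real.rpow_nonneg hx t) hpos.le
  · exact (withDensity_absolutelyContinuous μ _).ae_le hμ.nonneg
  · refine (hμ.integrable (t + p) (by positivity)).congr ?_
    filter_upwards [hμ.nonneg] with x hx using Real.rpow_add_of_nonneg hx ht hp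

theorem map_mul (hμ : FiniteMomentLaw μ) {a : ℝ} (ha : 0 ≤ a) :
    FiniteMomentLaw (μ.map fun x => a * x) := by
  have hm : Measurable fun x : ℝ => a * x := by fun_prop
  have := hμ.prob
  refine ⟨Measure.isProbabilityMeasure_map hm.aemeasurable, ?_, fun p hp => ?_⟩
  · rw [ae_map_iff hm.aemeasurable measurableSet_Ici]
    filter_upwards [hμ.nonneg] with x hx using mul_nonneg ha hx
  · rw [integrable_map_measure (by fun_prop) hm.aemeasurable]
    refine ((hμ.integrable p hp).const_mul (a ^ p)).congr ?_
    filter_upwards [hμ.nonneg] with x hx using (Real.mul_rpow ha hx).symm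

theorem integral_rpow_map_mul (hμ : FiniteMomentLaw μ) {a : ℝ} (ha : 0 ≤ a) (p : ℝ) :
    ∫ x, x ^ p ∂(μ.map fun x => a * x) = a ^ p * ∫ x, x ^ p ∂μ := by
  rw [integral_map (by fun_prop) (by fun_prop), ← integral_const_mul]
  refine integral_congr_ae ?_
  filter_upwards [hμ.nonneg] with x hx using Real.mul_rpow ha hx

end FiniteMomentLaw

theorem scaledLaw_eq_map_mul (μ : Measure ℝ) (ρ : ℝ → ℝ) (t : ℝ) :
    scaledLaw μ ρ t = (sizeBiased μ t).map fun x => (ρ t)⁻¹ * x := by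
  simp only [scaledLaw, div_eq_inv_mul]

theorem FiniteMomentLaw.scaledLaw (hμ : FiniteMomentLaw μ) (hμ0 : ¬ ∀ᵐ x ∂μ, x = 0)
    {ρ : ℝ → ℝ} {t : ℝ} (ht : 0 ≤ t) (hρ : 0 < ρ t) : FiniteMomentLaw (scaledLaw μ ρ t) := by
  rw [scaledLaw_eq_map_mul]
  exact (hμ.sizeBiased hμ0 ht).map_mul (inv_nonneg.2 hρ.le)

theorem integral_scaledLaw (hμ : ∀ᵐ x ∂μ, 0 ≤ x) (ρ : ℝ → ℝ) (t : ℝ) {f : ℝ → ℝ}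
    (hf : Measurable f) :
    ∫ x, f x ∂(scaledLaw μ ρ t) = (∫ x, x ^ t * f (x / ρ t) ∂μ) / ∫ x, x ^ t ∂μ := by
  rw [scaledLaw, integral_map (by fun_prop) hf.aestronglyMeasurable, integral_sizeBiased hμ]

theorem moment_scaledLaw (hμ : ∀ᵐ x ∂μ, 0 ≤ x) {ρ : ℝ → ℝ} {t p : ℝ} (ht : 0 ≤ t)
    (hρ : 0 < ρ t) (hp : 0 ≤ p) :
    ∫ x, x ^ p ∂(scaledLaw μ ρ t) =
      (∫ x, x ^ (t + p) ∂μ) / ((∫ x, x ^ t ∂μ) * ρ t ^ p) := by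
  rw [integral_scaledLaw hμ _ _ (by fun_prop), mul_comm, ← div_div]
  congr 1
  rw [← integral_div]
  refine integral_congr_ae ?_
  filter_upwards [hμ] with x hx
  rw [Real.div_rpow hx hρ.le, Real.rpow_add_of_nonneg hx ht hp]
  ring

/-- Size biasing `X_t` by `s` gives `(ρ (t + s) / ρ t) * X_{t + s}`. -/
theorem integral_mul_rpow_scaledLaw (hμ : FiniteMomentLaw μ) (hμ0 : ¬ ∀ᵐ x ∂μ, x = 0)
    {ρ : ℝ → ℝ} {t s : ℝ} (ht : 0 ≤ t) (hs : 0 ≤ s) (hρ : 0 < ρ t) (hρs : 0 < ρ (t + s))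
    {f : ℝ → ℝ} (hf : Measurable f) :
    ∫ x, f x * x ^ s ∂(scaledLaw μ ρ t) = (∫ x, x ^ s ∂(scaledLaw μ ρ t)) *
      ∫ x, f (ρ (t + s) / ρ t * x) ∂(scaledLaw μ ρ (t + s)) := by
  have := hμ.prob
  have h1 := integral_rpow_pos hμ.nonneg hμ0 (hμ.integrable t ht)
  have h2 := integral_rpow_pos hμ.nonneg hμ0 (hμ.integrable (t + s) (by positivity))
  have h3 : 0 < ρ t ^ s := Real.rpow_pos_of_pos hρ s
  rw [moment_scaledLaw hμ.nonneg ht hρ hs, integral_scaledLaw hμ.nonneg _ _ (by fun_prop),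
    integral_scaledLaw hμ.nonneg _ _ (by fun_prop)]
  have : ∫ x, x ^ t * (f (x / ρ t) * (x / ρ t) ^ s) ∂μ =
      (∫ x, x ^ (t + s) * f (ρ (t + s) / ρ t * (x / ρ (t + s))) ∂μ) / ρ t ^ s := by
    rw [← integral_div]
    refine integral_congr_ae ?_
    filter_upwards [hμ.nonneg] with x hx
    rw [Real.div_rpow hx hρ.le, Real.rpow_add_of_nonneg hx ht hs,
      show ρ (t + s) / ρ t * (x / ρ (t + s)) = x / ρ t by field_simp]
    ring
  rw [this]
  field_simp

/-- The case `f x = x ^ p` of the biasing identity. It drives both the moment bounds and the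
functional equation of the limit. -/
theorem moment_add_scaledLaw (hμ : FiniteMomentLaw μ) (hμ0 : ¬ ∀ᵐ x ∂μ, x = 0)
    {ρ : ℝ → ℝ} {t s p : ℝ} (ht : 0 ≤ t) (hs : 0 ≤ s) (hp : 0 ≤ p) (hρ : 0 < ρ t)
    (hρs : 0 < ρ (t + s)) :
    ∫ x, x ^ (s + p) ∂(scaledLaw μ ρ t) = (∫ x, x ^ s ∂(scaledLaw μ ρ t)) *
      ((ρ (t + s) / ρ t) ^ p * ∫ x, x ^ p ∂(scaledLaw μ ρ (t + s))) := by
  have h := integral_mul_rpow_scaledLaw hμ hμ0 ht hs hρ hρs (f := fun x => x ^ p) (by fun_prop)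
  have h1 : ∫ x, x ^ (s + p) ∂(scaledLaw μ ρ t) = ∫ x, x ^ p * x ^ s ∂(scaledLaw μ ρ t) := by
    refine integral_congr_ae ?_
    filter_upwards [(hμ.scaledLaw hμ0 ht hρ).nonneg] with x hx
    rw [add_comm, Real.rpow_add_of_nonneg hx hp hs]
  have h2 : ∫ x, (ρ (t + s) / ρ t * x) ^ p ∂(scaledLaw μ ρ (t + s)) =
      ∫ x, (ρ (t + s) / ρ t) ^ p * x ^ p ∂(scaledLaw μ ρ (t + s)) := by
    refine integral_congr_ae ?_
    filter_upwards [(hμ.scaledLaw hμ0 (add_nonneg ht hs) hρs).nonneg] with x hx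
    rw [Real.mul_rpow (by positivity) hx]
  rw [h1, h, h2, integral_const_mul]

end ScaledLaw

/-! ### Time sets. -/

/-- The properties of the time sets `ℕ` and `[0, ∞)` used for the equivalences. -/
structure IsTimeSet (T : Set ℝ) : Prop where
  nonneg : ∀ t ∈ T, 0 ≤ t
  one_mem : (1 : ℝ) ∈ T
  add_mem : ∀ s ∈ T, ∀ t ∈ T, s + t ∈ T

theorem isTimeSet_range_natCast : IsTimeSet (Set.range fun n : ℕ => (n : ℝ)) := by
  refine ⟨?_, ⟨1, by simp⟩, ?_⟩
  · rintro _ ⟨n, rfl⟩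
    exact n.cast_nonneg
  · rintro _ ⟨m, rfl⟩ _ ⟨n, rfl⟩
    exact ⟨m + n, by push_cast; rfl⟩

theorem isTimeSet_Ici : IsTimeSet (Set.Ici 0) :=
  ⟨fun _ ht => ht, Set.mem_Ici.2 zero_le_one, fun _ hs _ ht => Set.mem_Ici.2 (add_nonneg hs ht)⟩

namespace IsTimeSet

variable {T : Set ℝ}

theorem natCast_add_one_mem (hT : IsTimeSet T) (n : ℕ) : (n + 1 : ℝ) ∈ T := by
  induction n with
  | zero => simpa using hT.one_mem
  | succ n ih =>
    push_cast
    exact hT.add_mem _ ih _ hT.one_mem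

theorem neBot (hT : IsTimeSet T) : (infty T).NeBot := by
  rw [infty, inf_principal_neBot_iff]
  intro U hU
  obtain ⟨a, ha⟩ := mem_atTop_sets.1 hU
  obtain ⟨n, hn⟩ := exists_nat_ge a
  exact ⟨n + 1, ha _ (by linarith), hT.natCast_add_one_mem n⟩

theorem tendsto_add (hT : IsTimeSet T) {s : ℝ} (hs : s ∈ T) :
    Tendsto (fun t => t + s) (infty T) (infty T) := by
  refine tendsto_inf.2 ⟨?_, tendsto_principal.2 ?_⟩
  · exact (tendsto_atTop_add_const_right _ s tendsto_id).mono_left inf_le_left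
  · filter_upwards [mem_inf_of_right (mem_principal_self T)] with t ht
    exact hT.add_mem t ht s hs

end IsTimeSet

theorem eventually_mem_infty (T : Set ℝ) : ∀ᶠ t in infty T, t ∈ T :=
  mem_inf_of_right (mem_principal_self T)

/-! ### A bounded continuous substitute for tail indicators. -/

section TailRatio

/-- The bounded function `x ^ s / (K + x ^ s)` on the half-line, extended by zero. -/
noncomputable def tailRatio (s K x : ℝ) : ℝ := (max x 0) ^ s / (K + (max x 0) ^ s)

variable {s K : ℝ}

theorem posPart_rpow_nonneg (s x : ℝ) : 0 ≤ (max x 0) ^ s :=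
  Real.rpow_nonneg (le_max_right _ _) _

theorem tailRatio_nonneg (hK : 0 < K) (x : ℝ) : 0 ≤ tailRatio s K x :=
  div_nonneg (posPart_rpow_nonneg s x) (add_nonneg hK.le (posPart_rpow_nonneg s x))

theorem tailRatio_le_one (hK : 0 < K) (x : ℝ) : tailRatio s K x ≤ 1 := by
  have := posPart_rpow_nonneg s x
  rw [tailRatio, div_le_one (by linarith)]
  linarith

theorem abs_tailRatio_le (hK : 0 < K) (x : ℝ) : |tailRatio s K x| ≤ 1 := by
  rw [abs_of_nonneg (tailRatio_nonneg hK x)]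
  exact tailRatio_le_one hK x

theorem continuous_tailRatio (hs : 0 ≤ s) (hK : 0 < K) : Continuous (tailRatio s K) :=
  (continuous_posPart_rpow hs).div (continuous_const.add (continuous_posPart_rpow hs)) fun x =>
    (add_pos_of_pos_of_nonneg hK (posPart_rpow_nonneg s x)).ne'

theorem posPart_mul_rpow {r : ℝ} (hr : 0 ≤ r) (s x : ℝ) :
    (max (r * x) 0) ^ s = r ^ s * (max x 0) ^ s := by
  rw [← Real.mul_rpow hr (le_max_right _ _), mul_max_of_nonneg _ _ hr, mul_zero]

/-- For `r > 0`, dilating by `r` amounts to replacing `K` by `K / r ^ s`, and the ratio decreases in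
`K`. -/
theorem tailRatio_mul_le {r L : ℝ} (hr : 0 ≤ r) (hL : 0 < L) (hK : 0 < K) (h : r ^ s * L ≤ K)
    (x : ℝ) : tailRatio s K (r * x) ≤ tailRatio s L x := by
  have h1 := posPart_rpow_nonneg s x
  have h2 := Real.rpow_nonneg hr s
  rw [tailRatio, tailRatio, posPart_mul_rpow hr,
    div_le_div_iff₀ (by positivity) (by positivity)]
  nlinarith [mul_le_mul_of_nonneg_right h h1]

theorem le_tailRatio_mul {r L : ℝ} (hr : 0 ≤ r) (hL : 0 < L) (hK : 0 < K) (h : K ≤ r ^ s * L)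
    (x : ℝ) : tailRatio s L x ≤ tailRatio s K (r * x) := by
  have h1 := posPart_rpow_nonneg s x
  have h2 := Real.rpow_nonneg hr s
  rw [tailRatio, tailRatio, posPart_mul_rpow hr,
    div_le_div_iff₀ (by positivity) (by positivity)]
  nlinarith [mul_le_mul_of_nonneg_right h h1]

/-- This explains the shape of `tailRatio`: its integral against the unbounded weight `x ^ s`
reduces to a moment and a bounded expectation. -/
theorem tailRatio_mul_rpow (hK : 0 < K) {x : ℝ} (hx : 0 ≤ x) :
    tailRatio s K x * x ^ s = x ^ s - K * tailRatio s K x := by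
  have : 0 ≤ x ^ s := Real.rpow_nonneg hx s
  rw [tailRatio, max_eq_left hx]
  field_simp
  ring

theorem tendsto_integral_mul_tailRatio {ν : Measure ℝ} (hs : 0 ≤ s) {h : ℝ → ℝ}
    (hh : Integrable h ν) :
    Tendsto (fun K => ∫ x, tailRatio s K x * h x ∂ν) atTop (𝓝 0) := by
  have := tendsto_integral_filter_of_dominated_convergence (μ := ν) (l := atTop)
    (F := fun K x => tailRatio s K x * h x) (f := fun _ => 0) (fun x => ‖h x‖) ?_ ?_ hh.norm ?_
  · simpa using this
  · filter_upwards [eventually_gt_atTop 0] with K hK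
    exact (continuous_tailRatio hs hK).aestronglyMeasurable.mul hh.aestronglyMeasurable
  · filter_upwards [eventually_gt_atTop 0] with K hK
    refine ae_of_all _ fun x => ?_
    rw [norm_mul]
    exact mul_le_of_le_one_left (norm_nonneg _) (abs_tailRatio_le hK x)
  · refine ae_of_all _ fun x => ?_
    rw [← zero_mul (h x)]
    exact (tendsto_const_nhds.div_atTop
      (tendsto_atTop_add_const_right _ _ tendsto_id)).mul_const _

theorem integral_tailRatio_pos {ν : Measure ℝ} [IsProbabilityMeasure ν] (hν : ∀ᵐ x ∂ν, 0 ≤ x)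
    (hν0 : ¬ ∀ᵐ x ∂ν, x = 0) (hs : 0 ≤ s) (hK : 0 < K) : 0 < ∫ x, tailRatio s K x ∂ν := by
  have h0 : 0 ≤ tailRatio s K := fun x => tailRatio_nonneg hK x
  refine (integral_nonneg h0).lt_of_ne' fun h => hν0 ?_
  filter_upwards [(integral_eq_zero_iff_of_nonneg h0 (integrable_of_continuous_of_bounded
    (continuous_tailRatio hs hK) (abs_tailRatio_le hK))).1 h, hν] with x hx hx0
  by_contra hne
  have hpos : 0 < x ^ s := Real.rpow_pos_of_pos (lt_of_le_of_ne hx0 (Ne.symm hne)) s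
  rw [tailRatio, max_eq_left hx0] at hx
  exact (div_pos hpos (add_pos hK hpos)).ne' hx

end TailRatio

/-! ### The three equivalent conditions. -/

section Equivalence

variable {T : Set ℝ} {μ ν : Measure ℝ} {ρ : ℝ → ℝ}

theorem eventually_finiteMomentLaw_scaledLaw (hT : IsTimeSet T) (hμ : FiniteMomentLaw μ)
    (hμ0 : ¬ ∀ᵐ x ∂μ, x = 0) (hρ : ∀ t ∈ T, 0 < ρ t) :
    ∀ᶠ t in infty T, FiniteMomentLaw (scaledLaw μ ρ t) := by
  filter_upwards [eventually_mem_infty T] with t ht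
  exact hμ.scaledLaw hμ0 (hT.nonneg t ht) (hρ t ht)

/-- The biasing identity for `tailRatio`. Apart from the `s`-th moment and the ratio of `ρ`, only
expectations of bounded continuous functions occur, so it links the two unknowns. -/
theorem moment_sub_integral_tailRatio (hT : IsTimeSet T) (hμ : FiniteMomentLaw μ)
    (hμ0 : ¬ ∀ᵐ x ∂μ, x = 0) (hρ : ∀ t ∈ T, 0 < ρ t) {s t K : ℝ} (hs : s ∈ T) (ht : t ∈ T)
    (hK : 0 < K) :
    ∫ x, x ^ s ∂(scaledLaw μ ρ t) - K * ∫ x, tailRatio s K x ∂(scaledLaw μ ρ t) =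
      (∫ x, x ^ s ∂(scaledLaw μ ρ t)) *
        ∫ x, tailRatio s K (ρ (t + s) / ρ t * x) ∂(scaledLaw μ ρ (t + s)) := by
  have hs0 := hT.nonneg s hs
  have hlaw := hμ.scaledLaw hμ0 (hT.nonneg t ht) (hρ t ht)
  have := hlaw.prob
  rw [← integral_mul_rpow_scaledLaw hμ hμ0 (hT.nonneg t ht) hs0 (hρ t ht)
    (hρ _ (hT.add_mem t ht s hs)) (continuous_tailRatio hs0 hK).measurable,
    ← integral_const_mul, ← integral_sub (hlaw.integrable s hs0)
      ((integrable_of_continuous_of_bounded (continuous_tailRatio hs0 hK)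
        (abs_tailRatio_le hK)).const_mul K)]
  refine integral_congr_ae ?_
  filter_upwards [hlaw.nonneg] with x hx using (tailRatio_mul_rpow hK hx).symm

theorem integrable_tailRatio_mul {κ : Measure ℝ} [IsProbabilityMeasure κ] {s K : ℝ} (hs : 0 ≤ s)
    (hK : 0 < K) (r : ℝ) : Integrable (fun x => tailRatio s K (r * x)) κ :=
  integrable_of_continuous_of_bounded
    ((continuous_tailRatio hs hK).comp (continuous_const.mul continuous_id))
    fun _ => abs_tailRatio_le hK _

/-- Convergence of one positive moment bounds the ratios of the normalization. -/
theorem ratio_bounded_of_momentConverges [IsProbabilityMeasure ν] (hT : IsTimeSet T)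
    (hμ : FiniteMomentLaw μ) (hμ0 : ¬ ∀ᵐ x ∂μ, x = 0) (hρ : ∀ t ∈ T, 0 < ρ t)
    (hν : ∀ᵐ x ∂ν, 0 ≤ x) (hν0 : ¬ ∀ᵐ x ∂ν, x = 0)
    (hlaw : ConvergesInLaw (infty T) (scaledLaw μ ρ) ν) {s : ℝ} (hs : s ∈ T) (hs0 : s ≠ 0)
    (hm : MomentConverges (infty T) (scaledLaw μ ρ) ν s) :
    ∃ R : ℝ, ∀ᶠ t in infty T, ρ (t + s) / ρ t ≤ R := by
  have hs' := hT.nonneg s hs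
  -- `K` is taken so large that in the limit the tail of the biased law at level `K` is below that
  -- of `ν` at level `1`; a ratio with `r ^ s ≥ K` would reverse this strict inequality.
  have hpos : 0 < (∫ x, x ^ s ∂ν) * ∫ x, tailRatio s 1 x ∂ν :=
    mul_pos (integral_rpow_pos hν hν0 hm.1) (integral_tailRatio_pos hν hν0 hs' one_pos)
  obtain ⟨K, hKlt, hK⟩ := (((tendsto_integral_mul_tailRatio hs' hm.1).eventually_lt_const
    hpos).and (eventually_gt_atTop 0)).exists
  have hKeq : ∫ x, tailRatio s K x * x ^ s ∂ν =
      ∫ x, x ^ s ∂ν - K * ∫ x, tailRatio s K x ∂ν := by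
    rw [← integral_const_mul, ← integral_sub hm.1 ((integrable_of_continuous_of_bounded
      (continuous_tailRatio hs' hK) (abs_tailRatio_le hK)).const_mul K)]
    refine integral_congr_ae ?_
    filter_upwards [hν] with x hx using tailRatio_mul_rpow hK hx
  rw [hKeq] at hKlt
  have hlim1 := hm.2.sub ((hlaw.tendsto_integral (continuous_tailRatio hs' hK)
    (abs_tailRatio_le hK)).const_mul K)
  have hlim2 := hm.2.mul ((hlaw.tendsto_integral (continuous_tailRatio hs' one_pos)
    (abs_tailRatio_le one_pos)).comp (hT.tendsto_add hs))
  refine ⟨K ^ s⁻¹, ?_⟩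
  filter_upwards [hlim1.eventually_lt hlim2 hKlt, eventually_mem_infty T] with t hlt ht
  have htT := hT.add_mem t ht s hs
  have hr : 0 < ρ (t + s) / ρ t := div_pos (hρ _ htT) (hρ t ht)
  rw [moment_sub_integral_tailRatio hT hμ hμ0 hρ hs ht hK] at hlt
  have hl1 := hμ.scaledLaw hμ0 (hT.nonneg t ht) (hρ t ht)
  have hl2 := hμ.scaledLaw hμ0 (hT.nonneg _ htT) (hρ _ htT)
  have := hl2.prob
  have hrs : (ρ (t + s) / ρ t) ^ s < K := by
    by_contra hge
    refine hlt.not_ge (mul_le_mul_of_nonneg_left ?_ (integral_rpow_nonneg hl1.nonneg s))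
    refine integral_mono (integrable_of_continuous_of_bounded (continuous_tailRatio hs' one_pos)
      (abs_tailRatio_le one_pos)) (integrable_tailRatio_mul hs' hK _) fun x => ?_
    exact le_tailRatio_mul hr.le one_pos hK (by simpa using hge) x
  calc ρ (t + s) / ρ t = ((ρ (t + s) / ρ t) ^ s) ^ s⁻¹ := (Real.rpow_rpow_inv hr.le hs0).symm
    _ ≤ K ^ s⁻¹ := Real.rpow_le_rpow (Real.rpow_nonneg hr.le s) hrs.le (inv_nonneg.2 hs')

/-- Tightness of the size biased laws bounds the moments of the original ones. -/
theorem moment_bounded_of_ratio_bounded [IsProbabilityMeasure ν] (hT : IsTimeSet T)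
    (hμ : FiniteMomentLaw μ) (hμ0 : ¬ ∀ᵐ x ∂μ, x = 0) (hρ : ∀ t ∈ T, 0 < ρ t)
    (hlaw : ConvergesInLaw (infty T) (scaledLaw μ ρ) ν) {s R : ℝ} (hs : s ∈ T)
    (hR : ∀ᶠ t in infty T, ρ (t + s) / ρ t ≤ R) :
    ∃ C : ℝ, ∀ᶠ t in infty T, ∫ x, x ^ s ∂(scaledLaw μ ρ t) ≤ C := by
  have hs' := hT.nonneg s hs
  have hR0 : 0 < |R| + 1 := by positivity
  have hlim := tendsto_integral_mul_tailRatio (ν := ν) hs' (integrable_const (1 : ℝ))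
  simp only [mul_one] at hlim
  -- With `K = (|R| + 1) ^ s * L`, dilation by `r ≤ |R| + 1` keeps the tail term below `1 / 2`. The
  -- identity then reads `m - K * E ≤ m / 2` with `E ≤ 1`, whence the bound `2 * K`.
  obtain ⟨L, hLlt, hL⟩ := ((hlim.eventually_lt_const (show (0 : ℝ) < 1 / 2 by norm_num)).and
    (eventually_gt_atTop 0)).exists
  have hK : 0 < (|R| + 1) ^ s * L := by positivity
  refine ⟨2 * ((|R| + 1) ^ s * L), ?_⟩
  have hlim2 := (hlaw.tendsto_integral (continuous_tailRatio hs' hL)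
    (abs_tailRatio_le hL)).comp (hT.tendsto_add hs)
  filter_upwards [hlim2.eventually_lt_const hLlt, hR, eventually_mem_infty T] with t hlt hRt ht
  have htT := hT.add_mem t ht s hs
  have hr : 0 < ρ (t + s) / ρ t := div_pos (hρ _ htT) (hρ t ht)
  have hl1 := hμ.scaledLaw hμ0 (hT.nonneg t ht) (hρ t ht)
  have hl2 := hμ.scaledLaw hμ0 (hT.nonneg _ htT) (hρ _ htT)
  have := hl1.prob
  have := hl2.prob
  have hid := moment_sub_integral_tailRatio hT hμ hμ0 hρ hs ht hK
  set K := (|R| + 1) ^ s * L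
  have h1 : ∫ x, tailRatio s K (ρ (t + s) / ρ t * x) ∂(scaledLaw μ ρ (t + s)) ≤ 1 / 2 := by
    refine le_trans (integral_mono (integrable_tailRatio_mul hs' hK _)
      (integrable_of_continuous_of_bounded (continuous_tailRatio hs' hL) (abs_tailRatio_le hL))
      fun x => ?_) hlt.le
    refine tailRatio_mul_le hr.le hL hK ?_ x
    refine mul_le_mul_of_nonneg_right (Real.rpow_le_rpow hr.le ?_ hs') hL.le
    exact hRt.trans ((le_abs_self R).trans (by linarith))
  have h2 : ∫ x, tailRatio s K x ∂(scaledLaw μ ρ t) ≤ 1 := by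
    refine (integral_mono (integrable_of_continuous_of_bounded (continuous_tailRatio hs' hK)
      (abs_tailRatio_le hK)) (integrable_const (1 : ℝ)) fun x => tailRatio_le_one hK x).trans ?_
    simp
  have h3 := integral_rpow_nonneg hl1.nonneg s
  nlinarith [mul_le_mul_of_nonneg_left h1 h3, mul_le_mul_of_nonneg_left h2 hK.le]

/-- Peeling off one factor `x ^ s` moves the remaining moment of order `n * s` to time `t + s`,
where the previous bound holds eventually too. -/
theorem moment_nat_mul_bounded (hT : IsTimeSet T) (hμ : FiniteMomentLaw μ)
    (hμ0 : ¬ ∀ᵐ x ∂μ, x = 0) (hρ : ∀ t ∈ T, 0 < ρ t) {s R C : ℝ} (hs : s ∈ T)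
    (hR : ∀ᶠ t in infty T, ρ (t + s) / ρ t ≤ R)
    (hC : ∀ᶠ t in infty T, ∫ x, x ^ s ∂(scaledLaw μ ρ t) ≤ C) (n : ℕ) :
    ∃ D : ℝ, ∀ᶠ t in infty T, ∫ x, x ^ (n * s) ∂(scaledLaw μ ρ t) ≤ D := by
  have hs' := hT.nonneg s hs
  induction n with
  | zero =>
    refine ⟨1, ?_⟩
    filter_upwards [eventually_finiteMomentLaw_scaledLaw hT hμ hμ0 hρ] with t ht
    have := ht.prob
    simp
  | succ n ih =>
    obtain ⟨D, hD⟩ := ih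
    refine ⟨|C| * (|R| ^ (n * s) * |D|), ?_⟩
    filter_upwards [hR, hC, (hT.tendsto_add hs).eventually hD, eventually_mem_infty T]
      with t hRt hCt hDt ht
    have htT := hT.add_mem t ht s hs
    have hr : 0 < ρ (t + s) / ρ t := div_pos (hρ _ htT) (hρ t ht)
    have hl1 := hμ.scaledLaw hμ0 (hT.nonneg t ht) (hρ t ht)
    have hl2 := hμ.scaledLaw hμ0 (hT.nonneg _ htT) (hρ _ htT)
    have h1 := integral_rpow_nonneg hl1.nonneg s
    have h2 := integral_rpow_nonneg hl2.nonneg (n * s)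
    rw [show ((n + 1 : ℕ) : ℝ) * s = s + n * s by push_cast; ring,
      moment_add_scaledLaw hμ hμ0 (hT.nonneg t ht) hs' (by positivity) (hρ t ht) (hρ _ htT)]
    have h3 : (ρ (t + s) / ρ t) ^ (n * s) ≤ |R| ^ (n * s) :=
      Real.rpow_le_rpow hr.le (hRt.trans (le_abs_self R)) (by positivity)
    exact mul_le_mul (hCt.trans (le_abs_self C)) (mul_le_mul h3 (hDt.trans (le_abs_self D)) h2
      (by positivity)) (mul_nonneg (by positivity) h2) (abs_nonneg C)

theorem rpow_le_one_add_rpow {x p q : ℝ} (hx : 0 ≤ x) (hp : 0 ≤ p) (hpq : p ≤ q) :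
    x ^ p ≤ 1 + x ^ q := by
  rcases le_total x 1 with h | h
  · linarith [Real.rpow_le_one hx h hp, Real.rpow_nonneg hx q]
  · linarith [Real.rpow_le_rpow_of_exponent_le h hpq]

theorem FiniteMomentLaw.moment_le (hμ : FiniteMomentLaw μ) {p q : ℝ} (hp : 0 ≤ p) (hpq : p ≤ q) :
    ∫ x, x ^ p ∂μ ≤ 1 + ∫ x, x ^ q ∂μ := by
  have := hμ.prob
  have h := integral_mono_ae (hμ.integrable p hp)
    ((integrable_const (1 : ℝ)).add (hμ.integrable q (hp.trans hpq)))
    (by filter_upwards [hμ.nonneg] with x hx using rpow_le_one_add_rpow hx hp hpq)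
  rw [integral_add' (integrable_const _) (hμ.integrable q (hp.trans hpq))] at h
  simpa using h

theorem ConvLawAndMoment.convLawAndRatio [IsProbabilityMeasure ν] (hT : IsTimeSet T)
    (hμ : FiniteMomentLaw μ) (hμ0 : ¬ ∀ᵐ x ∂μ, x = 0) (hρ : ∀ t ∈ T, 0 < ρ t)
    (hν : ∀ᵐ x ∂ν, 0 ≤ x) (hν0 : ¬ ∀ᵐ x ∂ν, x = 0) (h : ConvLawAndMoment T μ ρ ν) :
    ConvLawAndRatio T μ ρ ν := by
  obtain ⟨hlaw, s, ⟨hs, hs0⟩, hm⟩ := h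
  obtain ⟨R, hR⟩ := ratio_bounded_of_momentConverges hT hμ hμ0 hρ hν hν0 hlaw hs hs0 hm
  refine ⟨hlaw, s, ⟨hs, hs0⟩, ?_⟩
  refine (limsup_le_of_le (h := ?_)).trans_lt (ENNReal.ofReal_lt_top (r := R))
  filter_upwards [hR] with t ht using ENNReal.ofReal_le_ofReal ht

theorem ConvLawAndRatio.convAllMoments [IsProbabilityMeasure ν] (hT : IsTimeSet T)
    (hμ : FiniteMomentLaw μ) (hμ0 : ¬ ∀ᵐ x ∂μ, x = 0) (hρ : ∀ t ∈ T, 0 < ρ t)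
    (hν : ∀ᵐ x ∂ν, 0 ≤ x) (h : ConvLawAndRatio T μ ρ ν) : ConvAllMoments T μ ρ ν := by
  obtain ⟨hlaw, s, ⟨hs, hs0⟩, hlim⟩ := h
  have := hT.neBot
  have hspos : 0 < s := lt_of_le_of_ne (hT.nonneg s hs) (Ne.symm hs0)
  obtain ⟨R, hlimR, -⟩ := ENNReal.lt_iff_exists_nnreal_btwn.1 hlim
  have hR : ∀ᶠ t in infty T, ρ (t + s) / ρ t ≤ R := by
    filter_upwards [eventually_lt_of_limsup_lt hlimR] with t ht
    rw [← ENNReal.ofReal_coe_nnreal] at ht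
    exact (ENNReal.ofReal_le_ofReal_iff R.coe_nonneg).1 ht.le
  obtain ⟨C, hC⟩ := moment_bounded_of_ratio_bounded hT hμ hμ0 hρ hlaw hs hR
  intro p hp
  -- Order `n * s ≥ 2 * p` is needed: the square of `x ^ p` must have bounded expectation.
  obtain ⟨n, hn⟩ := exists_nat_ge ((p + p) / s)
  obtain ⟨D, hD⟩ := moment_nat_mul_bounded hT hμ hμ0 hρ hs hR hC n
  have hev := eventually_finiteMomentLaw_scaledLaw hT hμ hμ0 hρ
  refine hlaw.momentConverges hν hev hp (C := 1 + D) ?_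
  filter_upwards [hD, hev] with t ht hlt
  have := hlt.moment_le (p := p + p) (q := n * s) (by positivity) ((div_le_iff₀ hspos).1 hn)
  linarith

theorem ConvAllMoments.convLawAndMoment [IsProbabilityMeasure ν] (hT : IsTimeSet T)
    (hμ : FiniteMomentLaw μ) (hμ0 : ¬ ∀ᵐ x ∂μ, x = 0) (hρ : ∀ t ∈ T, 0 < ρ t)
    (hν : ∀ᵐ x ∂ν, 0 ≤ x) (h : ConvAllMoments T μ ρ ν) : ConvLawAndMoment T μ ρ ν :=
  ⟨convergesInLaw_of_momentConverges hν (eventually_finiteMomentLaw_scaledLaw hT hμ hμ0 hρ) h,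
    1, ⟨hT.one_mem, one_ne_zero⟩, h 1 zero_le_one⟩

end Equivalence

/-! ### Lognormal laws and their moment indeterminacy. -/

section LogNormal

theorem integral_exp_mul_gaussianReal (b : ℝ) (v : ℝ≥0) (p : ℝ) :
    ∫ y, Real.exp (p * y) ∂(gaussianReal b v) = Real.exp (b * p + v * p ^ 2 / 2) :=
  congrFun mgf_id_gaussianReal p

theorem exp_rpow_eq (y p : ℝ) : Real.exp y ^ p = Real.exp (p * y) := by
  rw [← Real.exp_mul, mul_comm]

theorem map_log_map_exp (κ : Measure ℝ) : (κ.map Real.exp).map Real.log = κ := by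
  rw [Measure.map_map Real.measurable_log Real.measurable_exp,
    show Real.log ∘ Real.exp = id from funext Real.log_exp, Measure.map_id]

theorem ae_pos_map_exp (κ : Measure ℝ) : ∀ᵐ x ∂(κ.map Real.exp), 0 < x :=
  (ae_map_iff Real.measurable_exp.aemeasurable measurableSet_Ioi).2
    (ae_of_all _ fun y => Real.exp_pos y)

theorem integral_rpow_map_exp (κ : Measure ℝ) (p : ℝ) :
    ∫ x, x ^ p ∂(κ.map Real.exp) = ∫ y, Real.exp (p * y) ∂κ := by
  rw [integral_map Real.measurable_exp.aemeasurable (by fun_prop)]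
  simp only [exp_rpow_eq]

theorem integrable_rpow_map_exp {κ : Measure ℝ} {p : ℝ}
    (h : Integrable (fun y => Real.exp (p * y)) κ) :
    Integrable (fun x : ℝ => x ^ p) (κ.map Real.exp) := by
  rw [integrable_map_measure (by fun_prop) Real.measurable_exp.aemeasurable]
  exact h.congr (ae_of_all _ fun y => (exp_rpow_eq y p).symm)

theorem finiteMomentLaw_map_exp_gaussianReal (b : ℝ) (v : ℝ≥0) :
    FiniteMomentLaw ((gaussianReal b v).map Real.exp) :=
  ⟨Measure.isProbabilityMeasure_map Real.measurable_exp.aemeasurable,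
    (ae_pos_map_exp _).mono fun _ hx => hx.le,
    fun p _ => integrable_rpow_map_exp (integrable_exp_mul_gaussianReal p)⟩

/-- Two laws with the same exponential moments of integer order make every law with these
integer moments indeterminate. -/
theorem momentIndeterminate_of_ne {κ₁ κ₂ : Measure ℝ} [IsProbabilityMeasure κ₁]
    [IsProbabilityMeasure κ₂] (hne : κ₁ ≠ κ₂) {ν : Measure ℝ}
    (h₁ : ∀ n : ℕ, Integrable (fun y => Real.exp (n * y)) κ₁ ∧
      ∫ y, Real.exp (n * y) ∂κ₁ = ∫ x, x ^ n ∂ν)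
    (h₂ : ∀ n : ℕ, Integrable (fun y => Real.exp (n * y)) κ₂ ∧
      ∫ y, Real.exp (n * y) ∂κ₂ = ∫ x, x ^ n ∂ν) : MomentIndeterminate ν := by
  have key (κ : Measure ℝ) [IsProbabilityMeasure κ] (hκ : κ.map Real.exp ≠ ν)
      (h : ∀ n : ℕ, Integrable (fun y => Real.exp (n * y)) κ ∧
        ∫ y, Real.exp (n * y) ∂κ = ∫ x, x ^ n ∂ν) : MomentIndeterminate ν := by
    refine ⟨κ.map Real.exp, Measure.isProbabilityMeasure_map Real.measurable_exp.aemeasurable,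
      (ae_pos_map_exp κ).mono fun _ hx => hx.le, hκ, fun n => ?_⟩
    have h1 := integrable_rpow_map_exp (h n).1
    have h2 := integral_rpow_map_exp κ n
    simp only [Real.rpow_natCast] at h1 h2
    exact ⟨h1, h2.trans (h n).2⟩
  -- Since `Real.log` undoes `Real.exp`, the two images differ, so at least one of them is not `ν`.
  by_cases hν : κ₁.map Real.exp = ν
  · refine key κ₂ (fun h => hne ?_) h₂
    rw [← map_log_map_exp κ₁, ← map_log_map_exp κ₂, hν, h]
  · exact key κ₁ hν h₁

/-- This is the imaginary part of the Gaussian transform at `n + iθ`, centred at `b`. Its phase is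
`v * n * θ = 2πn` for `θ = 2π / v`, so the value is real. -/
theorem integral_exp_mul_sin_gaussianReal (b : ℝ) {v : ℝ≥0} (hv : v ≠ 0) (n : ℕ) :
    ∫ y, Real.exp (n * y) * Real.sin (2 * Real.pi / v * (y - b)) ∂(gaussianReal b v) = 0 := by
  set θ : ℝ := 2 * Real.pi / v with hθ
  have hvθ : (v : ℂ) * θ = 2 * Real.pi := by
    have : (v : ℝ) * θ = 2 * Real.pi := by
      rw [hθ]
      have : (v : ℝ) ≠ 0 := by exact_mod_cast hv
      field_simp
    exact_mod_cast this
  set z : ℂ := n + θ * Complex.I with hz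
  have hnorm (y : ℝ) : ‖Complex.exp (z * y - θ * b * Complex.I)‖ = Real.exp (n * y) := by
    rw [Complex.norm_exp]
    simp [hz]
  have hint : Integrable (fun y : ℝ => Complex.exp (z * y - θ * b * Complex.I))
      (gaussianReal b v) := by
    refine (integrable_exp_mul_gaussianReal (μ := b) (v := v) n).mono' (by fun_prop)
      (ae_of_all _ fun y => (hnorm y).le)
  have him (y : ℝ) : Real.exp (n * y) * Real.sin (θ * (y - b)) =
      (Complex.exp (z * y - θ * b * Complex.I)).im := by
    rw [Complex.exp_im]
    congr 2
    · simp [hz]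
    · simp [hz]
      ring
  have hval : ∫ y : ℝ, Complex.exp (z * y - θ * b * Complex.I) ∂(gaussianReal b v) =
      (Real.exp (n * b + v * (n ^ 2 - θ ^ 2) / 2) : ℝ) := by
    have h := complexMGF_id_gaussianReal (μ := b) (v := v) z
    simp only [complexMGF, id] at h
    simp_rw [sub_eq_add_neg, Complex.exp_add, integral_mul_const]
    rw [h, ← Complex.exp_add, Complex.ofReal_exp]
    -- The only place where `n` has to be an integer.
    rw [← mul_one (Complex.exp (Complex.ofReal _)), ← Complex.exp_nat_mul_two_pi_mul_I n,
      ← Complex.exp_add]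
    congr 1
    rw [← hvθ, hz]
    push_cast
    linear_combination (v * (θ : ℂ) ^ 2 / 2) * Complex.I_sq
  simp_rw [him]
  have := Complex.imCLM.integral_comp_comm hint
  simp only [Complex.imCLM_apply] at this
  rw [this, hval, Complex.ofReal_im]

/-- A Gaussian law with an oscillating perturbation that leaves the exponential moments of
integer order unchanged. -/
noncomputable def perturbedGaussian (b : ℝ) (v : ℝ≥0) : Measure ℝ :=
  (gaussianReal b v).withDensity fun y =>
    ENNReal.ofReal (1 + Real.sin (2 * Real.pi / v * (y - b)))

theorem one_add_sin_nonneg (x : ℝ) : 0 ≤ 1 + Real.sin x := by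
  linarith [Real.neg_one_le_sin x]

theorem integrable_exp_mul_sin_gaussianReal (b : ℝ) (v : ℝ≥0) (p θ : ℝ) :
    Integrable (fun y => Real.exp (p * y) * Real.sin (θ * (y - b))) (gaussianReal b v) := by
  refine (integrable_exp_mul_gaussianReal (μ := b) (v := v) p).mono' (by fun_prop)
    (ae_of_all _ fun y => ?_)
  rw [norm_mul, Real.norm_eq_abs, Real.abs_exp]
  exact mul_le_of_le_one_right (Real.exp_pos _).le (Real.abs_sin_le_one _)

theorem exp_moment_perturbedGaussian (b : ℝ) {v : ℝ≥0} (hv : v ≠ 0) (n : ℕ) :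
    Integrable (fun y => Real.exp (n * y)) (perturbedGaussian b v) ∧
      ∫ y, Real.exp (n * y) ∂(perturbedGaussian b v) =
        ∫ y, Real.exp (n * y) ∂(gaussianReal b v) := by
  have hm : Measurable fun y : ℝ =>
      ENNReal.ofReal (1 + Real.sin (2 * Real.pi / v * (y - b))) := by fun_prop
  have heq : (fun y : ℝ => (ENNReal.ofReal (1 + Real.sin (2 * Real.pi / v * (y - b)))).toReal •
      Real.exp (n * y)) = fun y => Real.exp (n * y) +
        Real.exp (n * y) * Real.sin (2 * Real.pi / v * (y - b)) := by
    ext y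
    rw [ENNReal.toReal_ofReal (one_add_sin_nonneg _), smul_eq_mul]
    ring
  have h1 := integrable_exp_mul_gaussianReal (μ := b) (v := v) n
  have h2 := integrable_exp_mul_sin_gaussianReal b v n (2 * Real.pi / v)
  constructor
  · rw [perturbedGaussian, integrable_withDensity_iff_integrable_smul' hm (by simp), heq]
    exact h1.add h2
  · rw [perturbedGaussian, integral_withDensity_eq_integral_toReal_smul hm (by simp), heq,
      integral_add h1 h2, integral_exp_mul_sin_gaussianReal b hv, add_zero]

theorem isProbabilityMeasure_perturbedGaussian (b : ℝ) {v : ℝ≥0} (hv : v ≠ 0) :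
    IsProbabilityMeasure (perturbedGaussian b v) := by
  obtain ⟨h1, h2⟩ := exp_moment_perturbedGaussian b hv 0
  simp only [Nat.cast_zero, zero_mul, Real.exp_zero] at h1 h2
  have : IsFiniteMeasure (perturbedGaussian b v) :=
    (integrable_const_iff_isFiniteMeasure one_ne_zero).1 h1
  rw [integral_const, integral_const] at h2
  simp only [smul_eq_mul, mul_one, probReal_univ] at h2
  exact ⟨by rw [← ofReal_measureReal, h2, ENNReal.ofReal_one]⟩

/-- Equality would make the sine vanish Lebesgue-a.e., hence everywhere by continuity, but at `b + v
/ 4` it equals `1`. -/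
theorem perturbedGaussian_ne (b : ℝ) {v : ℝ≥0} (hv : v ≠ 0) :
    gaussianReal b v ≠ perturbedGaussian b v := by
  intro h
  have hm : Measurable fun y : ℝ =>
      ENNReal.ofReal (1 + Real.sin (2 * Real.pi / v * (y - b))) := by fun_prop
  rw [perturbedGaussian] at h
  nth_rewrite 1 [← withDensity_one (μ := gaussianReal b v)] at h
  rw [withDensity_eq_iff_of_sigmaFinite (by fun_prop) hm.aemeasurable] at h
  have hv0 : (v : ℝ) ≠ 0 := by exact_mod_cast hv
  have h' : (fun y : ℝ => Real.sin (2 * Real.pi / v * (y - b))) =ᵐ[volume] fun _ => 0 := by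
    refine (gaussianReal_absolutelyContinuous' b hv).ae_le ?_
    filter_upwards [h] with y hy
    have := congrArg ENNReal.toReal hy
    rw [ENNReal.toReal_ofReal (one_add_sin_nonneg _)] at this
    simp only [Pi.one_apply, ENNReal.toReal_one] at this
    linarith
  have := congrFun ((Continuous.ae_eq_iff_eq volume (by fun_prop) continuous_const).1 h')
    (b + v / 4)
  rw [show 2 * Real.pi / v * (b + v / 4 - b) = Real.pi / 2 by field_simp; ring,
    Real.sin_pi_div_two] at this
  exact one_ne_zero this

/-- A law with the integer moments of a nondegenerate lognormal law is not determined by them. -/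
theorem momentIndeterminate_of_lognormal_moments (b : ℝ) {v : ℝ≥0} (hv : v ≠ 0) {ν : Measure ℝ}
    (h : ∀ n : ℕ, ∫ x, x ^ n ∂ν = ∫ y, Real.exp (n * y) ∂(gaussianReal b v)) :
    MomentIndeterminate ν := by
  have := isProbabilityMeasure_perturbedGaussian b hv
  refine momentIndeterminate_of_ne (perturbedGaussian_ne b hv)
    (fun n => ⟨integrable_exp_mul_gaussianReal _, (h n).symm⟩) fun n => ?_
  rw [h n]
  exact exp_moment_perturbedGaussian b hv n

end LogNormal

/-! ### Functional equation and identification of the limit. -/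

section LimitLaw

variable {T : Set ℝ} {μ ν : Measure ℝ} {ρ : ℝ → ℝ}

theorem ConvAllMoments.finiteMomentLaw [IsProbabilityMeasure ν] (hν : ∀ᵐ x ∂ν, 0 ≤ x)
    (h : ConvAllMoments T μ ρ ν) : FiniteMomentLaw ν :=
  ⟨inferInstance, hν, fun p hp => (h p hp).1⟩

/-- With `p = 1` the moment identity is linear in the ratio, which can be solved for in terms of
converging moments. -/
theorem ConvAllMoments.tendsto_ratio [IsProbabilityMeasure ν] (hT : IsTimeSet T)
    (hμ : FiniteMomentLaw μ) (hμ0 : ¬ ∀ᵐ x ∂μ, x = 0) (hρ : ∀ t ∈ T, 0 < ρ t)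
    (hν : ∀ᵐ x ∂ν, 0 ≤ x) (hν0 : ¬ ∀ᵐ x ∂ν, x = 0) (h : ConvAllMoments T μ ρ ν)
    {s : ℝ} (hs : s ∈ T) :
    Tendsto (fun t => ρ (t + s) / ρ t) (infty T)
      (𝓝 ((∫ x, x ^ (s + 1) ∂ν) / ((∫ x, x ^ s ∂ν) * ∫ x, x ^ (1 : ℝ) ∂ν))) := by
  have hs' := hT.nonneg s hs
  have h1 := h 1 zero_le_one
  have hpos := mul_pos (integral_rpow_pos hν hν0 (h s hs').1) (integral_rpow_pos hν hν0 h1.1)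
  have hden := (h s hs').2.mul (h1.2.comp (hT.tendsto_add hs))
  refine ((h (s + 1) (by positivity)).2.div hden hpos.ne').congr' ?_
  filter_upwards [hden.eventually_const_lt hpos, eventually_mem_infty T] with t hpt ht
  simp only [Pi.div_apply, Function.comp_apply] at hpt ⊢
  rw [div_eq_iff hpt.ne', moment_add_scaledLaw hμ hμ0 (hT.nonneg t ht) hs' zero_le_one (hρ t ht)
    (hρ _ (hT.add_mem t ht s hs)), Real.rpow_one]
  ring

theorem ConvAllMoments.moment_add [IsProbabilityMeasure ν] (hT : IsTimeSet T)
    (hμ : FiniteMomentLaw μ) (hμ0 : ¬ ∀ᵐ x ∂μ, x = 0) (hρ : ∀ t ∈ T, 0 < ρ t)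
    (h : ConvAllMoments T μ ρ ν) {s p k : ℝ} (hs : s ∈ T) (hp : 0 ≤ p)
    (hk : Tendsto (fun t => ρ (t + s) / ρ t) (infty T) (𝓝 k)) :
    ∫ x, x ^ (s + p) ∂ν = (∫ x, x ^ s ∂ν) * (k ^ p * ∫ x, x ^ p ∂ν) := by
  have hs' := hT.nonneg s hs
  have := hT.neBot
  refine tendsto_nhds_unique (h (s + p) (by positivity)).2 (Tendsto.congr' ?_
    ((h s hs').2.mul ((hk.rpow_const (Or.inr hp)).mul ((h p hp).2.comp (hT.tendsto_add hs)))))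
  filter_upwards [eventually_mem_infty T] with t ht
  exact (moment_add_scaledLaw hμ hμ0 (hT.nonneg t ht) hs' hp (hρ t ht)
    (hρ _ (hT.add_mem t ht s hs))).symm

/-- Nonnegativity of the variance; it is what makes the exponent `c` nonnegative. -/
theorem FiniteMomentLaw.sq_moment_one_le (hν : FiniteMomentLaw ν) :
    (∫ x, x ^ (1 : ℝ) ∂ν) * ∫ x, x ^ (1 : ℝ) ∂ν ≤ ∫ x, x ^ ((1 : ℝ) + 1) ∂ν := by
  have := hν.prob
  set m := ∫ x, x ^ (1 : ℝ) ∂ν with hm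
  have h1 := hν.integrable 1 zero_le_one
  have h2 := hν.integrable (1 + 1) (by norm_num)
  have h3 : 0 ≤ ∫ x, (x ^ ((1 : ℝ) + 1) - 2 * m * x ^ (1 : ℝ)) + m * m ∂ν := by
    refine integral_nonneg fun x => ?_
    have : x ^ ((1 : ℝ) + 1) = x * x := by norm_num; ring
    simp only [this, Real.rpow_one, Pi.zero_apply]
    nlinarith [sq_nonneg (x - m)]
  have h4 : Integrable (fun x => x ^ ((1 : ℝ) + 1) - 2 * m * x ^ (1 : ℝ)) ν :=
    h2.sub (h1.const_mul _)
  rw [integral_add h4 (integrable_const _),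
    integral_sub h2 (h1.const_mul _), integral_const_mul, ← hm] at h3
  simp only [integral_const, probReal_univ, one_smul] at h3
  linarith

/-- The ratios of the normalization converge exponentially, and the moments of the limit satisfy
the corresponding functional equation. -/
theorem ConvAllMoments.exists_exponent [IsProbabilityMeasure ν] (hT : IsTimeSet T)
    (hμ : FiniteMomentLaw μ) (hμ0 : ¬ ∀ᵐ x ∂μ, x = 0) (hρ : ∀ t ∈ T, 0 < ρ t)
    (hν : ∀ᵐ x ∂ν, 0 ≤ x) (hν0 : ¬ ∀ᵐ x ∂ν, x = 0) (h : ConvAllMoments T μ ρ ν) :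
    ∃ c : ℝ≥0,
      (∀ s ∈ T, Tendsto (fun t => ρ (t + s) / ρ t) (infty T) (𝓝 (Real.exp (c * s)))) ∧
      ∀ s ∈ T, ∀ p, 0 ≤ p →
        ∫ x, x ^ (s + p) ∂ν = (∫ x, x ^ s ∂ν) * (Real.exp (c * s) ^ p * ∫ x, x ^ p ∂ν) := by
  have hlaw := h.finiteMomentLaw hν
  have hm1 := integral_rpow_pos hν hν0 (h 1 zero_le_one).1
  have hlim1 := h.tendsto_ratio hT hμ hμ0 hρ hν hν0 hT.one_mem
  set k := (∫ x, x ^ ((1 : ℝ) + 1) ∂ν) / ((∫ x, x ^ (1 : ℝ) ∂ν) * ∫ x, x ^ (1 : ℝ) ∂ν) with hk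
  have hk1 : 1 ≤ k := (one_le_div (mul_pos hm1 hm1)).2 hlaw.sq_moment_one_le
  have hexp (s : ℝ) : Real.exp (Real.log k * s) = k ^ s :=
    (Real.rpow_def_of_pos (by linarith) s).symm
  have hratio : ∀ s ∈ T, Tendsto (fun t => ρ (t + s) / ρ t) (infty T)
      (𝓝 (Real.exp (Real.log k * s))) := by
    intro s hs
    have hlim := h.tendsto_ratio hT hμ hμ0 hρ hν hν0 hs
    have hs' := hT.nonneg s hs
    have hms := integral_rpow_pos hν hν0 (h s hs').1
    convert hlim using 2
    -- The functional equation for the shift `1` already holds for every real `p ≥ 0`; at `p = s` it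
    -- turns the limit ratio into `k ^ s`, without any regularity in `s`.
    rw [hexp, add_comm s 1, h.moment_add hT hμ hμ0 hρ hT.one_mem hs' hlim1]
    field_simp
  exact ⟨⟨Real.log k, Real.log_nonneg hk1⟩, hratio, fun s hs p hp =>
    h.moment_add hT hμ hμ0 hρ hs hp (hratio s hs)⟩

/-- Only the first moment matters: `E[X_t] = E[X^(t+1)] / (E[X^t] ρ_t)` tends to `E[X_∞]`. -/
theorem ConvAllMoments.isEquivalent [IsProbabilityMeasure ν] (hT : IsTimeSet T)
    (hμ : FiniteMomentLaw μ) (hμ0 : ¬ ∀ᵐ x ∂μ, x = 0) (hρ : ∀ t ∈ T, 0 < ρ t)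
    (hν : ∀ᵐ x ∂ν, 0 ≤ x) (hν0 : ¬ ∀ᵐ x ∂ν, x = 0) (h : ConvAllMoments T μ ρ ν) :
    ρ ~[infty T] fun t => (1 / ∫ x, x ∂ν) * ((∫ x, x ^ (t + 1) ∂μ) / ∫ x, x ^ t ∂μ) := by
  have := hμ.prob
  have h1 := h 1 zero_le_one
  have hm1 := integral_rpow_pos hν hν0 h1.1
  have hlim := (tendsto_const_nhds (x := ∫ x, x ^ (1 : ℝ) ∂ν)).div h1.2 hm1.ne'
  rw [div_self hm1.ne'] at hlim
  simp only [Real.rpow_one] at hm1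
  have hM (t : ℝ) (ht : 0 ≤ t) := integral_rpow_pos hμ.nonneg hμ0 (hμ.integrable t ht)
  rw [isEquivalent_iff_tendsto_one]
  · refine hlim.congr' ?_
    filter_upwards [eventually_mem_infty T] with t ht
    have ht0 := hT.nonneg t ht
    have hMt := hM t ht0
    have hMt1 := hM (t + 1) (by positivity)
    have hρt := hρ t ht
    simp only [Pi.div_apply]
    rw [moment_scaledLaw hμ.nonneg ht0 hρt zero_le_one]
    simp only [Real.rpow_one]
    field_simp
  · filter_upwards [eventually_mem_infty T] with t ht
    have ht0 := hT.nonneg t ht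
    have hMt := hM t ht0
    have hMt1 := hM (t + 1) (by positivity)
    positivity

/-- The functional equation equates the moments of both laws. It is available for all real `p` even
when `s` is an integer, so uniqueness applies over `ℕ` as well, despite integer indeterminacy. -/
theorem sizeBiased_eq_map_mul (hν : FiniteMomentLaw ν) (hν0 : ¬ ∀ᵐ x ∂ν, x = 0) {s k : ℝ}
    (hs : 0 ≤ s) (hk : 0 ≤ k) (h : ∀ p, 0 ≤ p →
      ∫ x, x ^ (s + p) ∂ν = (∫ x, x ^ s ∂ν) * (k ^ p * ∫ x, x ^ p ∂ν)) :
    sizeBiased ν s = ν.map fun x => k * x := by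
  have := hν.prob
  refine (hν.sizeBiased hν0 hs).ext (hν.map_mul hk) fun p hp => ?_
  have hpos := integral_rpow_pos hν.nonneg hν0 (hν.integrable s hs)
  rw [integral_sizeBiased hν.nonneg, hν.integral_rpow_map_mul hk, div_eq_iff hpos.ne',
    mul_comm _ (∫ x, x ^ s ∂ν), ← h p hp]
  refine integral_congr_ae ?_
  filter_upwards [hν.nonneg] with x hx using (Real.rpow_add_of_nonneg hx hs hp).symm

/-- The functional equation on `ℕ` determines the integer moments. -/
theorem eq_exp_quadratic_of_nat {m : ℝ → ℝ} {a c : ℝ} (h0 : m 0 = 1) (h1 : m 1 = Real.exp a)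
    (h : ∀ p, 0 ≤ p → m (1 + p) = m 1 * (Real.exp (c * 1) ^ p * m p)) (n : ℕ) :
    m n = Real.exp ((a - c / 2) * n + c / 2 * (n : ℝ) ^ 2) := by
  induction n with
  | zero => simp [h0]
  | succ n ih =>
    rw [Nat.cast_succ, add_comm, h n n.cast_nonneg, ih, h1, exp_rpow_eq, ← Real.exp_add,
      ← Real.exp_add]
    congr 1
    ring

/-- An additive function on the half-line that vanishes at `1` and is bounded above on the unit
interval vanishes. -/
theorem additive_eq_zero_of_le {g : ℝ → ℝ} {B : ℝ}
    (hadd : ∀ x y, 0 ≤ x → 0 ≤ y → g (x + y) = g x + g y) (h1 : g 1 = 0)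
    (hB : ∀ x, 0 ≤ x → x ≤ 1 → g x ≤ B) {x : ℝ} (hx : 0 ≤ x) : g x = 0 := by
  have h0 : g 0 = 0 := by simpa using hadd 0 0 le_rfl le_rfl
  have hmul (n : ℕ) {y : ℝ} (hy : 0 ≤ y) : g (n * y) = n * g y := by
    induction n with
    | zero => simp [h0]
    | succ n ih =>
      push_cast
      rw [add_mul, one_mul, hadd _ _ (by positivity) hy, ih]
      ring
  have hper (n : ℕ) {y : ℝ} (hy : 0 ≤ y) : g (n + y) = g y := by
    have := hmul n zero_le_one
    rw [h1, mul_zero, mul_one] at this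
    rw [hadd _ _ n.cast_nonneg hy, this, zero_add]
  have hfloor {y : ℝ} (hy : 0 ≤ y) : ∃ z, 0 ≤ z ∧ z ≤ 1 ∧ g y = g z := by
    have hz : 0 ≤ y - ⌊y⌋₊ := sub_nonneg.2 (Nat.floor_le hy)
    refine ⟨y - ⌊y⌋₊, hz, by linarith [Nat.lt_floor_add_one y], ?_⟩
    conv_lhs => rw [← add_sub_cancel (⌊y⌋₊ : ℝ) y]
    exact hper _ hz
  -- A positive value would have unbounded multiples `n * g y`, yet by periodicity these are values
  -- on the unit interval.
  have hle {y : ℝ} (hy : 0 ≤ y) : g y ≤ 0 := by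
    by_contra! hpos
    obtain ⟨n, hn⟩ := exists_nat_gt (B / g y)
    obtain ⟨z, hz0, hz1, hz⟩ := hfloor (mul_nonneg n.cast_nonneg hy)
    rw [div_lt_iff₀ hpos, ← hmul n hy, hz] at hn
    exact hn.not_ge (hB z hz0 hz1)
  obtain ⟨z, hz0, hz1, hz⟩ := hfloor hx
  -- Two nonpositive values with sum `g 1 = 0` both vanish.
  have hsum := hadd z (1 - z) hz0 (by linarith)
  rw [add_sub_cancel, h1] at hsum
  rw [hz]
  linarith [hle hz0, hle (sub_nonneg.2 hz1)]

/-- The functional equation on `[0, ∞)` determines all moments. -/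
theorem eq_exp_quadratic_of_nonneg {m : ℝ → ℝ} {a c B : ℝ} (hpos : ∀ p, 0 ≤ p → 0 < m p)
    (h1 : m 1 = Real.exp a) (hB : ∀ p, 0 ≤ p → p ≤ 1 → m p ≤ B)
    (h : ∀ s, 0 ≤ s → ∀ p, 0 ≤ p → m (s + p) = m s * (Real.exp (c * s) ^ p * m p)) {p : ℝ}
    (hp : 0 ≤ p) : m p = Real.exp ((a - c / 2) * p + c / 2 * p ^ 2) := by
  -- The cross term `c * x * y` of `log m` is the polarization of `c / 2 * p ^ 2`, so subtracting
  -- the quadratic leaves an additive function; the linear coefficient makes it vanish at `1`.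
  have key := additive_eq_zero_of_le
    (g := fun p => Real.log (m p) - ((a - c / 2) * p + c / 2 * p ^ 2))
    (B := Real.log B + |a - c / 2| + |c / 2|) ?_ ?_ ?_ hp
  · rw [← sub_eq_zero.1 key, Real.exp_log (hpos p hp)]
  · intro x y hx hy
    rw [h x hx y hy, exp_rpow_eq, Real.log_mul (hpos x hx).ne'
      (mul_pos (Real.exp_pos _) (hpos y hy)).ne', Real.log_mul (Real.exp_pos _).ne'
      (hpos y hy).ne', Real.log_exp]
    ring
  · rw [h1, Real.log_exp]
    ring
  · intro x hx hx1
    have h1 := Real.log_le_log (hpos x hx) (hB x hx hx1)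
    have h2 : -(|a - c / 2| * 1) ≤ (a - c / 2) * x := by
      have := abs_mul (a - c / 2) x
      have := neg_abs_le ((a - c / 2) * x)
      have := mul_le_mul_of_nonneg_left ((abs_of_nonneg hx).le.trans hx1) (abs_nonneg (a - c / 2))
      linarith
    have h3 : -(|c / 2| * 1) ≤ c / 2 * x ^ 2 := by
      have := abs_mul (c / 2) (x ^ 2)
      have := neg_abs_le (c / 2 * x ^ 2)
      have := mul_le_mul_of_nonneg_left ((abs_of_nonneg (sq_nonneg x)).le.trans
        (pow_le_one₀ hx hx1)) (abs_nonneg (c / 2))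
      linarith
    linarith

end LimitLaw

end SizeBias

/-! ### The main theorem. -/

theorem theorem3
    -- the time set is `ℕ` or `[0, ∞)`
    (T : Set ℝ) (hT : T = Set.range (fun n : ℕ => (n : ℝ)) ∨ T = Set.Ici 0)
    -- the law `μ` of `X`: nonnegative, not identically null, with all positive moments
    (μ : Measure ℝ) [IsProbabilityMeasure μ] (hμ_nonneg : ∀ᵐ x ∂μ, 0 ≤ x)
    (hμ_nonnull : ¬ ∀ᵐ x ∂μ, x = 0)
    (hμ_moments : ∀ p : ℝ, 0 ≤ p → Integrable (fun x : ℝ => x ^ p) μ)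
    -- the normalization
    (ρ : ℝ → ℝ) (hρ : ∀ t ∈ T, 0 < ρ t)
    -- the law `ν` of `X_∞`: nonnegative and non-null
    (ν : Measure ℝ) [IsProbabilityMeasure ν] (hν_nonneg : ∀ᵐ x ∂ν, 0 ≤ x)
    (hν_nonnull : ¬ ∀ᵐ x ∂ν, x = 0) :
    List.TFAE
      [SizeBias.ConvLawAndMoment T μ ρ ν,
        SizeBias.ConvLawAndRatio T μ ρ ν,
        SizeBias.ConvAllMoments T μ ρ ν] ∧
    (SizeBias.ConvLawAndMoment T μ ρ ν →
      (ρ ~[SizeBias.infty T]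
        fun t => (1 / ∫ x, x ∂ν) * ((∫ x, x ^ (t + 1) ∂μ) / ∫ x, x ^ t ∂μ)) ∧
      ∃ c : ℝ≥0,
        (∀ s ∈ T, Tendsto (fun t => ρ (t + s) / ρ t) (SizeBias.infty T)
          (𝓝 (Real.exp (c * s)))) ∧
        ∃ a : ℝ, a = Real.log (∫ x, x ∂ν) ∧
          (T = Set.range (fun n : ℕ => (n : ℝ)) →
            (0 < c → SizeBias.MomentIndeterminate ν) ∧
            ∀ n : ℕ,
              ∫ x, x ^ n ∂ν = ∫ y, Real.exp (n * y) ∂(gaussianReal (a - c / 2) c) ∧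
              ∫ x, x ^ n ∂ν = Real.exp ((a - c / 2) * n + c / 2 * (n : ℝ) ^ 2)) ∧
          (T = Set.Ici 0 →
            (∀ᵐ x ∂ν, 0 < x) ∧
            ν.map Real.log = gaussianReal (a - c / 2) c ∧
            ∀ p : ℝ, 0 ≤ p →
              ∫ x, x ^ p ∂ν = ∫ y, Real.exp (p * y) ∂(gaussianReal (a - c / 2) c) ∧
              ∫ x, x ^ p ∂ν = Real.exp ((a - c / 2) * p + c / 2 * p ^ 2)) ∧
          ∀ s ∈ T, SizeBias.sizeBiased ν s = ν.map (fun x => Real.exp (c * s) * x)) := by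

  have hTS : SizeBias.IsTimeSet T := by
    rcases hT with rfl | rfl
    · exact SizeBias.isTimeSet_range_natCast
    · exact SizeBias.isTimeSet_Ici
  have hμ : SizeBias.FiniteMomentLaw μ := ⟨inferInstance, hμ_nonneg, hμ_moments⟩
  have h12 : SizeBias.ConvLawAndMoment T μ ρ ν → SizeBias.ConvLawAndRatio T μ ρ ν := fun h =>
    h.convLawAndRatio hTS hμ hμ_nonnull hρ hν_nonneg hν_nonnull
  have h23 : SizeBias.ConvLawAndRatio T μ ρ ν → SizeBias.ConvAllMoments T μ ρ ν := fun h =>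
    h.convAllMoments hTS hμ hμ_nonnull hρ hν_nonneg
  have h31 : SizeBias.ConvAllMoments T μ ρ ν → SizeBias.ConvLawAndMoment T μ ρ ν := fun h =>
    h.convLawAndMoment hTS hμ hμ_nonnull hρ hν_nonneg
  refine ⟨by tfae_have 1 → 2 := h12
             tfae_have 2 → 3 := h23
             tfae_have 3 → 1 := h31
             tfae_finish, fun hconv => ?_⟩
  have h := h23 (h12 hconv)
  have hν := h.finiteMomentLaw hν_nonneg
  obtain ⟨c, hratio, hmom⟩ := h.exists_exponent hTS hμ hμ_nonnull hρ hν_nonneg hν_nonnull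
  refine ⟨h.isEquivalent hTS hμ hμ_nonnull hρ hν_nonneg hν_nonnull, c, hratio, _, rfl, ?_, ?_, ?_⟩
  all_goals set a := Real.log (∫ x, x ∂ν) with ha
  all_goals
    have hm0 : ∫ x, x ^ (0 : ℝ) ∂ν = 1 := by simp
    have hm1 : ∫ x, x ^ (1 : ℝ) ∂ν = Real.exp a := by
      have := SizeBias.integral_rpow_pos hν_nonneg hν_nonnull (hν.integrable 1 zero_le_one)
      simp only [Real.rpow_one] at this ⊢
      rw [ha, Real.exp_log this]
  · rintro -
    have hn (n : ℕ) :
        ∫ x, x ^ n ∂ν = Real.exp ((a - c / 2) * n + c / 2 * (n : ℝ) ^ 2) := by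
      have := SizeBias.eq_exp_quadratic_of_nat (m := fun p => ∫ x, x ^ p ∂ν) hm0 hm1
        (hmom 1 hTS.one_mem) n
      simpa only [Real.rpow_natCast] using this
    have hg (n : ℕ) :
        ∫ x, x ^ n ∂ν = ∫ y, Real.exp (n * y) ∂(gaussianReal (a - c / 2) c) := by
      rw [hn, SizeBias.integral_exp_mul_gaussianReal]
      congr 1
      ring
    exact ⟨fun hc => SizeBias.momentIndeterminate_of_lognormal_moments _ hc.ne' hg,
      fun n => ⟨hg n, hn n⟩⟩
  · intro hTI
    have hp (p : ℝ) (hp : 0 ≤ p) :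
        ∫ x, x ^ p ∂ν = Real.exp ((a - c / 2) * p + c / 2 * p ^ 2) :=
      SizeBias.eq_exp_quadratic_of_nonneg (m := fun p => ∫ x, x ^ p ∂ν)
        (fun q hq => SizeBias.integral_rpow_pos hν_nonneg hν_nonnull (hν.integrable q hq)) hm1
        -- On the unit interval the moments are bounded by `1` plus the first moment, which is the
        -- local bound that excludes pathological additive solutions.
        (fun q hq hq1 => hν.moment_le hq hq1) (fun s hs => hmom s (hTI ▸ hs)) hp
    have hg (p : ℝ) (hp0 : 0 ≤ p) :
        ∫ x, x ^ p ∂ν = ∫ y, Real.exp (p * y) ∂(gaussianReal (a - c / 2) c) := by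
      rw [hp p hp0, SizeBias.integral_exp_mul_gaussianReal]
      congr 1
      ring
    have hlaw : ν = (gaussianReal (a - c / 2) c).map Real.exp :=
      hν.ext (SizeBias.finiteMomentLaw_map_exp_gaussianReal _ _) fun p hp0 => by
        rw [hg p hp0, SizeBias.integral_rpow_map_exp]
    refine ⟨?_, ?_, fun p hp0 => ⟨hg p hp0, hp p hp0⟩⟩
    · rw [hlaw]
      exact SizeBias.ae_pos_map_exp _
    · conv_lhs => rw [hlaw]
      exact SizeBias.map_log_map_exp _
  · intro s hs
    exact SizeBias.sizeBiased_eq_map_mul hν hν_nonnull (hTS.nonneg s hs) (Real.exp_pos _).le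
      (hmom s hs)
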